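/- **Conventions.** A plane tree is a finite rooted binary plane tree (every vertex has 0 or 2 ordered children); its vertices are words in the letters $1,2$, $L(\mathbb t)$ is its set of leaves, $|\mathbb t|=\#L(\mathbb t)$, $\mathbb t_u$ is the subtree rooted at the vertex $u$, and $\mathbb T$ is the set of plane trees. $\mathbb P_n$ is the uniform probability on the plane trees with $n$ leaves. *Skeleton.* For an integer $a\ge 0$ let $\mathbb t[a]=\{u\in\mathbb t: |\mathbb t_v|>a \text{ for every strict ancestor } v \text{ of } u\}$. For a plane tree $\mathbb t$ with $|\mathbb t|\ge 2$, its contraction $\Pi(\mathbb t)=(\mathbb s,{\bf x})$ is obtained as follows. Let $U(\mathbb t)$ be the internal vertex $u$ of $\mathbb t$ such that each strict ancestor of $u$ has exactly one child that is a leaf, and the two children of $u$ are both leaves or both internal vertices. If they are leaves, $\mathbb s=\{\varnothing\}$ and $x_\varnothing=|U(\mathbb t)|$, the height of $U(\mathbb t)$. Otherwise the root of $\mathbb s$ has label $|U(\mathbb t)|$ and its two labelled subtrees are, in order, $\Pi(\mathbb t_{U(\mathbb t)1})$ and $\Pi(\mathbb t_{U(\mathbb t)2})$. This identifies each vertex $u$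 of $\mathbb s$ with a vertex $\pi_{\mathbb t}(u)$ of $\mathbb t$, namely $\pi_{\mathbb t}(\varnothing)=U(\mathbb t)$ and $\pi_{\mathbb t}(ui)=U$ of the subtree at $\pi_{\mathbb t}(u)i$, regarded as a vertex of $\mathbb t$. If $|\mathbb t|>a$, the $a$-skeleton of $\mathbb t$ is ${\rm Sk}_a(\mathbb t)=(\mathbb s,{\bf x},{\bf y})$ with $(\mathbb s,{\bf x})=\Pi(\mathbb t[a])$ and $y_u=|\mathbb t_{\pi_{\mathbb t[a]}(u)}|$ for $u\in L(\mathbb s)$. *Functions.* Fix $\epsilon\in(0,1)$. For $\mathbb s\in\mathbb T$ and $M>1/\epsilon$ let $$I_M(\mathbb s)=\{({\bf x},{\bf y})\in\mathbb R_+^{\mathbb s}\times\mathbb R_+^{L(\mathbb s)}:\ x_u\in(M^{-1},M)\ (u\in\mathbb s),\ y_u\in(\epsilon+M^{-1},2\epsilon)\ (u\in L(\mathbb s))\}.$$ Let $g(x)=\dfrac{e^{-1/(4x)}}{2\sqrt\pi\,x^{3/2}}$ for $x>0$ and $g(x)=0$ for $x\le 0$, let $a_1(x)=\dfrac{\mathbf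 1_{x\ge\epsilon}}{2\sqrt\pi\,x^{3/2}}$, for $k\ge2$ let $$a_k(x)=\frac1{(4\pi)^{k/2}}\int_{u_1,\dots,u_{k-1}\ge\epsilon}\frac{\mathbf 1_{\{u_1+\dots+u_{k-1}\le x-\epsilon\}}\,du_1\cdots du_{k-1}}{(u_1\cdots u_{k-1}(x-u_1-\dots-u_{k-1}))^{3/2}},$$ and let $b(y)=\dfrac1{4\pi}\displaystyle\int_{y-\epsilon}^{\epsilon}\frac{du}{(u(y-u))^{3/2}}$ for $y\in(\epsilon,2\epsilon]$. With $|{\bf x}|=\sum_u x_u$, $|{\bf y}|=\sum_u y_u$ and $z=1-|{\bf y}|$, put $\psi^{\mathbb s}({\bf x},{\bf y})=0$ if $z<0$, and otherwise $$\psi^{\mathbb s}({\bf x},{\bf y})=\frac{\sqrt\pi}{2^{2|\mathbb s|-2}}\left(\frac1{|{\bf x}|^2}\,g\!\left(\frac z{|{\bf x}|^2}\right)+\sum_{k=1}^{\lfloor z/\epsilon\rfloor}\frac{(-|{\bf x}|)^{k-2}}{k!}\int_{k\epsilon}^{z}g\!\left(\frac{z-u}{|{\bf x}|^2}\right)a_k(u)\,du\right)\prod_{v\in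 L(\mathbb s)}b(y_v).$$ **Proposition.** Let $\mathbb s\in\mathbb T$. Then for every $\epsilon\in(0,1)$ and $M>1/\epsilon$, $$\sup_{\substack{({\bf x},{\bf y})\in\mathbb Z_+^{\mathbb s}\times\mathbb Z_+^{L(\mathbb s)}\\ ({\bf x}/\sqrt n,{\bf y}/n)\in I_M(\mathbb s)}}\left|n^{2|\mathbb s|-1/2}\,\mathbb P_n\bigl({\rm Sk}_{\lfloor\epsilon n\rfloor}=(\mathbb s,{\bf x},{\bf y})\bigr)-\psi^{\mathbb s}({\bf x}/\sqrt n,{\bf y}/n)\right|\longrightarrow0\qquad(n\to\infty),$$ where the supremum over an empty set is $0$. -/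

import Mathlib

open Filter Topology

/-- A (rooted, binary) plane tree: `nil` is the one-vertex tree, and `node () l r` is the tree
whose root has first child subtree `l` and second child subtree `r`.  The size `|t|` is the
number of leaves, `t.numLeaves`. -/
abbrev PlaneTree : Type := BinaryTree Unit

/-- Words over the alphabet `{1, 2}`, with `false` for the letter `1` and `true` for `2`. -/
abbrev Word : Type := List Bool

namespace PlaneTree

open BinaryTree

/-- The set of vertices of a plane tree, as a set of words. -/
def verts : PlaneTree → Finset Word
  | nil => {[]}
  | node _ l r => insert [] ((verts l).image (List.cons false) ∪ (verts r).image (List.cons true))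

/-- The set `L(t)` of leaves of a plane tree, as a set of words. -/
def leaves : PlaneTree → Finset Word
  | nil => {[]}
  | node _ l r => (leaves l).image (List.cons false) ∪ (leaves r).image (List.cons true)

/-- The subtree `t_u` of `t` rooted at its vertex `u` (it is used only for vertices `u` of `t`). -/
def subtree : PlaneTree → Word → PlaneTree
  | t, [] => t
  | nil, _ :: _ => nil
  | node _ l _, false :: u => subtree l u
  | node _ _ r, true :: u => subtree r u

/-- The `a`-trimming `t[a] = {u ∈ t : |t_v| > a for every strict ancestor v of u}`. -/
def trim (a : ℕ) : PlaneTree → PlaneTree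
  | nil => nil
  | node c l r => if a < (node c l r).numLeaves then node c (trim a l) (trim a r) else nil

/-- The vertex `U(t)` at which the chain of degree-two vertices that starts at the root ends once
the leaves of `t` are suppressed: the internal vertex `u` of `t` such that exactly one child of
each strict ancestor of `u` is a leaf, while the children of `u` are both leaves or both
internal vertices.  (It is used only for `|t| ≥ 2`.) -/
def branchPoint : PlaneTree → Word
  | nil => []
  | node _ nil nil => []
  | node _ nil (node c l r) => true :: branchPoint (node c l r)
  | node _ (node c l r) nil => false :: branchPoint (node c l r)
  | node _ (node _ _ _) (node _ _ _) => []

/-- The plane tree of the contraction `Π(t)`: all leaves of `t` are suppressed, and then the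
maximal chains of vertices with a single remaining child are contracted.
(It is used only for `|t| ≥ 2`.) -/
def contractShape : PlaneTree → PlaneTree
  | nil => nil
  | node _ nil nil => nil
  | node _ nil (node c l r) => contractShape (node c l r)
  | node _ (node c l r) nil => contractShape (node c l r)
  | node _ (node c l r) (node c' l' r') =>
      node () (contractShape (node c l r)) (contractShape (node c' l' r'))

/-- The map `π_t` from the vertices of `Π(t)` to those of `t`:
`π_t(∅) = U(t)`, and `π_t(i u) = U(t) i π_{t'}(u)` where `t'` is the subtree at `U(t) i`. -/
def contractMap : PlaneTree → Word → Word
  | t, [] => branchPoint t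
  | t, i :: u => branchPoint t ++ i :: contractMap (subtree t (branchPoint t ++ [i])) u

/-- The labels of `Π(t)`: the root has label `|U(t)|`, and the labels below its child `i` are
those of the contraction of the subtree of `t` at `U(t) i`. -/
def contractLabel : PlaneTree → Word → ℕ
  | t, [] => (branchPoint t).length
  | t, i :: u => contractLabel (subtree t (branchPoint t ++ [i])) u

/-- A plane tree with integer labels `x` on its vertices and `y` on its leaves. -/
structure Skeleton where
  shape : PlaneTree
  x : shape.verts → ℕ
  y : shape.leaves → ℕ

/-- The `a`-skeleton of a plane tree `t` (meaningful for `|t| > a`): `(s, x) = Π(t[a])`, and `y_u`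
is the number of leaves of `t` below the vertex `π_{t[a]}(u)`. -/
def skeleton (a : ℕ) (t : PlaneTree) : Skeleton where
  shape := contractShape (trim a t)
  x := fun u => contractLabel (trim a t) u
  y := fun u => (subtree t (contractMap (trim a t) u)).numLeaves

/-- The set of plane trees with `n` leaves. -/
def ofSize (n : ℕ) : Set PlaneTree := {t | t.numLeaves = n}

/-- The uniform probability on the (finite) set of plane trees with `n` leaves. -/
noncomputable def uniformProb (n : ℕ) (A : Set PlaneTree) : ℝ :=
  ((ofSize n ∩ A).ncard : ℝ) / ((ofSize n).ncard : ℝ)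

/-- The box `I_M(s)` (for `0 < ε` and `0 < M` its elements have nonnegative coordinates). -/
def box (ε M : ℝ) (s : PlaneTree) : Set ((s.verts → ℝ) × (s.leaves → ℝ)) :=
  {p | (∀ u, p.1 u ∈ Set.Ioo M⁻¹ M) ∧ ∀ v, p.2 v ∈ Set.Ioo (ε + M⁻¹) (2 * ε)}

/-- The density of the stable law of index `1/2` with Laplace transform `exp (-√λ)`. -/
noncomputable def stableDensity (x : ℝ) : ℝ :=
  if 0 < x then Real.exp (-1 / (4 * x)) / (2 * √Real.pi * x ^ (3 / 2 : ℝ)) else 0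

/-- The functions `a_k`, for `k ≥ 1`: `jumpDensity ε k` is `a_{k+1}`. -/
noncomputable def jumpDensity (ε : ℝ) : ℕ → ℝ → ℝ
  | 0, x => if ε ≤ x then 1 / (2 * √Real.pi * x ^ (3 / 2 : ℝ)) else 0
  | k + 1, x =>
      1 / (4 * Real.pi) ^ (((k : ℝ) + 2) / 2) *
        ∫ u in {u : Fin (k + 1) → ℝ | (∀ i, ε ≤ u i) ∧ ∑ i, u i ≤ x - ε},
          1 / ((∏ i, u i) * (x - ∑ i, u i)) ^ (3 / 2 : ℝ)

/-- The function `b`. -/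
noncomputable def forkDensity (ε y : ℝ) : ℝ :=
  1 / (4 * Real.pi) * ∫ u in (y - ε)..ε, 1 / (u * (y - u)) ^ (3 / 2 : ℝ)

/-- `convolvedDensity ε w z k` is `∫ g((z - u) / w ^ 2) a_k(u) du` over `[k ε, z]`, where for
`k = 0` the measure `a_0(u) du` is the Dirac mass at `0` (the law of an empty sum). -/
noncomputable def convolvedDensity (ε w z : ℝ) : ℕ → ℝ
  | 0 => stableDensity (z / w ^ 2)
  | k + 1 => ∫ u in (((k : ℝ) + 1) * ε)..z, stableDensity ((z - u) / w ^ 2) * jumpDensity ε k u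

/-- The limiting density `ψ^s`.  With `w = |x|` and `z = 1 - |y|`, the sum is over the integers
`0 ≤ k ≤ ⌊z / ε⌋`; it is empty when `z < 0`. -/
noncomputable def limitDensity (ε : ℝ) (s : PlaneTree) (x : s.verts → ℝ) (y : s.leaves → ℝ) : ℝ :=
  √Real.pi / 2 ^ (2 * (s.numLeaves : ℤ) - 2) *
    (∑ k ∈ Finset.range (⌊(1 - ∑ v, y v) / ε⌋ + 1).toNat,
      (-∑ u, x u) ^ ((k : ℤ) - 2) / (k.factorial : ℝ) *
        convolvedDensity ε (∑ u, x u) (1 - ∑ v, y v) k) *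
    ∏ v, forkDensity ε (y v)

end PlaneTree

/-! Put a = ⌊εn⌋. A tree with a given a-skeleton (s, x, y) is assembled freely: each of the |x|
chain vertices carries, on its left or on its right, a tree with at most a leaves, and each leaf v
of s carries a fork of two such trees with y_v leaves in all. If S is the generating function of the
trees with at most a leaves, their number is therefore the product of the coefficients of S² at the
y_v, times the coefficient of (2S)^|x| at n - |y| (`genFun_skeletonWeight`). Rescaling the variable
by 4 turns 2S into the restriction to {1, ..., a} of the law `stepProb` of the number of leaves of a
critical binary Galton-Watson tree, and the powers of 4 cancel (`uniformProb_skeleton_eq_stepProb`).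

Each factor has a limit. Since `stepProb p` is asymptotic to p^(-3/2) / (2√π), a fork coefficient
times n² is a Riemann sum converging to b (`tendsto_coeff_sub_sq`). There remains the probability
that about w√n steps, none larger than εn, add up to n - |y|. Inclusion-exclusion over the large
steps (`intCoeff_sub_pow`) has boundedly many nonzero terms, because more than 1/ε large steps
exceed n. In the k-th term the choice of the large steps gives w^k/k!, their sizes have density a_1,
and the sum of the other steps obeys a local limit theorem with density g: the ballot formula
expresses its law by one binomial coefficient, to which Stirling's formula applies
(`tendsto_coeff_stepSeries_pow`, `tendsto_tailProb`).

Uniformity comes from compactness. Convergence holds along every sequence whose rescaled labels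
converge in the closed box, and ψ is continuous there, so a sequence of violations would have a
contradictory subsequence. -/

namespace PlaneTree

open BinaryTree

/-! ### Counting trees with a given skeleton -/

/-- The finite set of plane trees with `n` leaves. -/
def treesOfSize : ℕ → Finset PlaneTree
  | 0 => ∅
  | n + 1 => treesOfNumNodesEq n

lemma mem_treesOfSize {t : PlaneTree} {n : ℕ} : t ∈ treesOfSize n ↔ t.numLeaves = n := by
  cases n with
  | zero => simp [treesOfSize, numLeaves_eq_numNodes_succ]
  | succ n => simp [treesOfSize, numLeaves_eq_numNodes_succ, mem_treesOfNumNodesEq]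

lemma card_treesOfSize_succ (n : ℕ) : (treesOfSize (n + 1)).card = catalan n :=
  treesOfNumNodesEq_card_eq_catalan n

lemma ncard_ofSize_inter (n : ℕ) (A : Set PlaneTree) [DecidablePred (· ∈ A)] :
    (ofSize n ∩ A).ncard = ((treesOfSize n).filter (· ∈ A)).card := by
  rw [← Set.ncard_coe_finset]
  congr 1
  ext t
  simp [ofSize, mem_treesOfSize]

lemma ncard_ofSize_succ (n : ℕ) : (ofSize (n + 1)).ncard = catalan n := by
  rw [← card_treesOfSize_succ, ← Set.ncard_coe_finset]
  congr 1
  ext t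
  simp [ofSize, mem_treesOfSize]

/-- The generating function, by number of leaves, of plane trees with weights. -/
noncomputable def genFun (w : PlaneTree → ℝ) : PowerSeries ℝ :=
  PowerSeries.mk fun n => ∑ t ∈ treesOfSize n, w t

lemma genFun_add (w₁ w₂ : PlaneTree → ℝ) :
    genFun (fun t => w₁ t + w₂ t) = genFun w₁ + genFun w₂ := by
  ext n
  simp [genFun, Finset.sum_add_distrib]

/-- The number of leaves is additive over the two subtrees at the root, so cutting at the root turns
a product weight into a Cauchy product. The hypothesis `h₀` discards the one-vertex tree, which has
no such cut. -/
lemma genFun_node (w w₁ w₂ : PlaneTree → ℝ) (h₀ : w nil = 0)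
    (h : ∀ l r, w (node () l r) = w₁ l * w₂ r) : genFun w = genFun w₁ * genFun w₂ := by
  ext n
  simp only [genFun, PowerSeries.coeff_mul, PowerSeries.coeff_mk]
  simp_rw [Finset.sum_mul_sum, ← Finset.sum_product']
  rw [Finset.sum_sigma']
  symm
  refine Finset.sum_of_injOn (fun q => node () q.2.1 q.2.2) ?_ ?_ ?_ ?_
  · rintro ⟨⟨p, q⟩, l, r⟩ hx ⟨⟨p', q'⟩, l', r'⟩ hy hxy
    simp only [Finset.coe_sigma, Set.mem_sigma_iff, Finset.mem_coe, Finset.mem_product,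
      mem_treesOfSize] at hx hy
    simp only [node.injEq, true_and] at hxy
    obtain ⟨rfl, rfl⟩ := hxy
    obtain ⟨-, rfl, rfl⟩ := hx
    obtain ⟨-, rfl, rfl⟩ := hy
    rfl
  · rintro ⟨⟨p, q⟩, l, r⟩ hx
    simp only [Finset.coe_sigma, Set.mem_sigma_iff, Finset.mem_coe, Finset.mem_product,
      mem_treesOfSize] at hx
    simp only [Finset.mem_coe, mem_treesOfSize, numLeaves, hx.2.1, hx.2.2]
    exact Finset.HasAntidiagonal.mem_antidiagonal.1 hx.1
  · intro t ht hn
    cases t with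
    | nil => exact h₀
    | node c l r =>
      refine absurd ⟨⟨⟨l.numLeaves, r.numLeaves⟩, l, r⟩, ?_, rfl⟩ hn
      simpa [mem_treesOfSize] using ht
  · rintro ⟨⟨p, q⟩, l, r⟩ hx
    exact (h l r).symm

/-- The weight that selects the trees with at most `a` leaves. -/
def smallWeight (a : ℕ) (t : PlaneTree) : ℝ := if t.numLeaves ≤ a then 1 else 0

/-- The labels of `t`'s `a`-skeleton, given by functions on all words, are `X` and `Y`,
and its shape is `s`. -/
def HasSkeleton (a : ℕ) (s : PlaneTree) (X Y : Word → ℕ) (t : PlaneTree) : Prop :=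
  contractShape (trim a t) = s ∧ (∀ u ∈ verts s, contractLabel (trim a t) u = X u) ∧
    ∀ v ∈ leaves s, (subtree t (contractMap (trim a t) v)).numLeaves = Y v

open Classical in
/-- The weight that selects the trees with more than `a` leaves and a given `a`-skeleton. -/
noncomputable def skeletonWeight (a : ℕ) (s : PlaneTree) (X Y : Word → ℕ) (t : PlaneTree) : ℝ :=
  if a < t.numLeaves ∧ HasSkeleton a s X Y t then 1 else 0

@[simp] lemma nil_mem_verts (s : PlaneTree) : [] ∈ verts s := by cases s <;> simp [verts]

lemma prod_leaves_node {M : Type*} [CommMonoid M] (f : Word → M) (l r : PlaneTree) :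
    ∏ v ∈ leaves (node () l r), f v =
      (∏ v ∈ leaves l, f (false :: v)) * ∏ v ∈ leaves r, f (true :: v) := by
  rw [leaves, Finset.prod_union, Finset.prod_image, Finset.prod_image]
  · simp
  · simp
  · simp only [Finset.disjoint_left, Finset.mem_image]
    rintro _ ⟨v, -, rfl⟩ ⟨w, -, h⟩
    simp at h

lemma sum_leaves_node {M : Type*} [AddCommMonoid M] (f : Word → M) (l r : PlaneTree) :
    ∑ v ∈ leaves (node () l r), f v =
      (∑ v ∈ leaves l, f (false :: v)) + ∑ v ∈ leaves r, f (true :: v) := by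
  rw [leaves, Finset.sum_union, Finset.sum_image, Finset.sum_image]
  · simp
  · simp
  · simp only [Finset.disjoint_left, Finset.mem_image]
    rintro _ ⟨v, -, rfl⟩ ⟨w, -, h⟩
    simp at h

lemma sum_verts_node {M : Type*} [AddCommMonoid M] (f : Word → M) (l r : PlaneTree) :
    ∑ v ∈ verts (node () l r), f v =
      f [] + ((∑ v ∈ verts l, f (false :: v)) + ∑ v ∈ verts r, f (true :: v)) := by
  rw [verts, Finset.sum_insert, Finset.sum_union, Finset.sum_image, Finset.sum_image]
  · simp
  · simp
  · simp only [Finset.disjoint_left, Finset.mem_image]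
    rintro _ ⟨v, -, rfl⟩ ⟨w, -, h⟩
    simp at h
  · simp

lemma card_leaves (s : PlaneTree) : (leaves s).card = s.numLeaves := by
  induction s with
  | nil => simp [leaves]
  | node c l r hl hr =>
    have := sum_leaves_node (fun _ => (1 : ℕ)) l r
    simp only [Finset.sum_const, smul_eq_mul, mul_one] at this
    rw [this, hl, hr, numLeaves]

lemma trim_of_le {a : ℕ} {t : PlaneTree} (h : t.numLeaves ≤ a) : trim a t = nil := by
  cases t with
  | nil => rfl
  | node c l r => rw [trim, if_neg (not_lt.2 h)]

lemma exists_trim_eq_node {a : ℕ} (ha : 1 ≤ a) {t : PlaneTree} (h : a < t.numLeaves) :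
    ∃ c l r, trim a t = node c l r := by
  cases t with
  | nil => simp at h; omega
  | node c l r => exact ⟨c, _, _, by rw [trim, if_pos h]⟩

variable {a : ℕ} {s l r : PlaneTree} {X Y : Word → ℕ}

/-- Trimming reduces a subtree with at most a leaves to a single leaf, and for a ≥ 1 only such a
subtree. Comparing the sizes of the two root subtrees with a thus decides the role of the root,
which gives four cases. Here the root is the end of the first chain and a leaf of the shape. -/
lemma hasSkeleton_small_small (h : a < (node () l r : PlaneTree).numLeaves)
    (hl : l.numLeaves ≤ a) (hr : r.numLeaves ≤ a) :
    HasSkeleton a s X Y (node () l r) ↔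
      s = nil ∧ X [] = 0 ∧ l.numLeaves + r.numLeaves = Y [] := by
  have : trim a (node () l r) = node () nil nil := by
    rw [trim, if_pos h, trim_of_le hl, trim_of_le hr]
  rw [HasSkeleton, this]
  simp only [contractShape]
  constructor
  · rintro ⟨rfl, h₁, h₂⟩
    exact ⟨rfl, by simpa [contractLabel, branchPoint, verts, eq_comm] using h₁,
      by simpa [leaves, contractMap, branchPoint, subtree] using h₂⟩
  · rintro ⟨rfl, h₁, h₂⟩
    exact ⟨rfl, by simpa [contractLabel, branchPoint, verts, eq_comm] using h₁,
      by simpa [leaves, contractMap, branchPoint, subtree] using h₂⟩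

lemma contractMap_node_nil_left (c : Unit) (l r : PlaneTree) (u : Word) :
    contractMap (node () nil (node c l r)) u = true :: contractMap (node c l r) u := by
  cases u <;> simp [contractMap, branchPoint, subtree]

lemma contractMap_node_nil_right (c : Unit) (l r : PlaneTree) (u : Word) :
    contractMap (node () (node c l r) nil) u = false :: contractMap (node c l r) u := by
  cases u <;> simp [contractMap, branchPoint, subtree]

/-- The root lies on the first chain; deleting it shortens that chain by one and changes no other
label. -/
lemma hasSkeleton_small_large (ha : 1 ≤ a) (hl : l.numLeaves ≤ a) (hr : a < r.numLeaves) :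
    HasSkeleton a s X Y (node () l r) ↔
      0 < X [] ∧ HasSkeleton a s (Function.update X [] (X [] - 1)) Y r := by
  have h : a < (node () l r : PlaneTree).numLeaves := by rw [numLeaves]; omega
  obtain ⟨c, p, q, hpq⟩ := exists_trim_eq_node ha hr
  have : trim a (node () l r) = node () nil (node c p q) := by
    rw [trim, if_pos h, trim_of_le hl, hpq]
  rw [HasSkeleton, HasSkeleton, this, hpq]
  simp only [contractShape, contractMap_node_nil_left, subtree]
  have key : (∀ u ∈ verts s, contractLabel (node () nil (node c p q)) u = X u) ↔
      0 < X [] ∧ ∀ u ∈ verts s, contractLabel (node c p q) u =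
        Function.update X [] (X [] - 1) u := by
    constructor
    · intro hx
      have h0 := hx [] (nil_mem_verts s)
      simp only [contractLabel, branchPoint, List.length_cons] at h0
      refine ⟨by omega, fun u hu => ?_⟩
      cases u with
      | nil => simp [contractLabel]; omega
      | cons i u =>
        rw [Function.update_of_ne (by simp), ← hx _ hu]
        simp [contractLabel, branchPoint, subtree]
    · rintro ⟨h0, hx⟩ u hu
      have := hx u hu
      cases u with
      | nil => simp [contractLabel, branchPoint] at this ⊢; omega
      | cons i u =>
        rw [Function.update_of_ne (by simp)] at this
        rw [← this]
        simp [contractLabel, branchPoint, subtree]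
  rw [key]
  tauto

lemma hasSkeleton_large_small (ha : 1 ≤ a) (hl : a < l.numLeaves) (hr : r.numLeaves ≤ a) :
    HasSkeleton a s X Y (node () l r) ↔
      0 < X [] ∧ HasSkeleton a s (Function.update X [] (X [] - 1)) Y l := by
  have h : a < (node () l r : PlaneTree).numLeaves := by rw [numLeaves]; omega
  obtain ⟨c, p, q, hpq⟩ := exists_trim_eq_node ha hl
  have : trim a (node () l r) = node () (node c p q) nil := by
    rw [trim, if_pos h, trim_of_le hr, hpq]
  rw [HasSkeleton, HasSkeleton, this, hpq]
  simp only [contractShape, contractMap_node_nil_right, subtree]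
  have key : (∀ u ∈ verts s, contractLabel (node () (node c p q) nil) u = X u) ↔
      0 < X [] ∧ ∀ u ∈ verts s, contractLabel (node c p q) u =
        Function.update X [] (X [] - 1) u := by
    constructor
    · intro hx
      have h0 := hx [] (nil_mem_verts s)
      simp only [contractLabel, branchPoint, List.length_cons] at h0
      refine ⟨by omega, fun u hu => ?_⟩
      cases u with
      | nil => simp [contractLabel]; omega
      | cons i u =>
        rw [Function.update_of_ne (by simp), ← hx _ hu]
        simp [contractLabel, branchPoint, subtree]
    · rintro ⟨h0, hx⟩ u hu
      have := hx u hu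
      cases u with
      | nil => simp [contractLabel, branchPoint] at this ⊢; omega
      | cons i u =>
        rw [Function.update_of_ne (by simp)] at this
        rw [← this]
        simp [contractLabel, branchPoint, subtree]
  rw [key]
  tauto

/-- The root is a branch point of the trimmed tree, so the first chain has length 0 and the skeleton
splits. -/
lemma hasSkeleton_large_large (ha : 1 ≤ a) (hl : a < l.numLeaves) (hr : a < r.numLeaves) :
    HasSkeleton a s X Y (node () l r) ↔
      ∃ s₁ s₂, s = node () s₁ s₂ ∧ X [] = 0 ∧
        HasSkeleton a s₁ (fun u => X (false :: u)) (fun u => Y (false :: u)) l ∧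
        HasSkeleton a s₂ (fun u => X (true :: u)) (fun u => Y (true :: u)) r := by
  have h : a < (node () l r : PlaneTree).numLeaves := by rw [numLeaves]; omega
  obtain ⟨c, p, q, hpq⟩ := exists_trim_eq_node ha hl
  obtain ⟨c', p', q', hpq'⟩ := exists_trim_eq_node ha hr
  have : trim a (node () l r) = node () (node c p q) (node c' p' q') := by
    rw [trim, if_pos h, hpq, hpq']
  simp only [HasSkeleton, this, hpq, hpq', contractShape]
  constructor
  · rintro ⟨rfl, hx, hy⟩
    refine ⟨_, _, rfl, ?_, ⟨rfl, fun u hu => ?_, fun v hv => ?_⟩, rfl, fun u hu => ?_,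
      fun v hv => ?_⟩
    · rw [← hx [] (nil_mem_verts _)]; simp [contractLabel, branchPoint]
    · rw [← hx (false :: u) (by simp [verts, hu])]
      simp [contractLabel, branchPoint, subtree]
    · rw [← hy (false :: v) (by simp [leaves, hv])]
      simp [contractMap, branchPoint, subtree]
    · rw [← hx (true :: u) (by simp [verts, hu])]
      simp [contractLabel, branchPoint, subtree]
    · rw [← hy (true :: v) (by simp [leaves, hv])]
      simp [contractMap, branchPoint, subtree]
  · rintro ⟨s₁, s₂, rfl, h0, ⟨h₁, hx₁, hy₁⟩, h₂, hx₂, hy₂⟩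
    refine ⟨by rw [h₁, h₂], fun u hu => ?_, fun v hv => ?_⟩
    · simp only [verts, Finset.mem_insert, Finset.mem_union, Finset.mem_image] at hu
      rcases hu with rfl | ⟨v, hv, rfl⟩ | ⟨v, hv, rfl⟩
      · rw [h0]; simp [contractLabel, branchPoint]
      · rw [← hx₁ v hv]; simp [contractLabel, branchPoint, subtree]
      · rw [← hx₂ v hv]; simp [contractLabel, branchPoint, subtree]
    · simp only [leaves, Finset.mem_union, Finset.mem_image] at hv
      rcases hv with ⟨v, hv, rfl⟩ | ⟨v, hv, rfl⟩
      · rw [← hy₁ v hv]; simp [contractMap, branchPoint, subtree]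
      · rw [← hy₂ v hv]; simp [contractMap, branchPoint, subtree]

lemma skeletonWeight_nil (ha : 1 ≤ a) : skeletonWeight a s X Y nil = 0 := by
  rw [skeletonWeight, if_neg]
  simp only [numLeaves]
  omega

/-- A positive root label forces exactly one root subtree to be small. The two sides on which it may
lie are `w₁` and `w₂`, whence the factor 2. -/
lemma genFun_skeletonWeight_of_pos (ha : 1 ≤ a) (hX : 0 < X []) :
    genFun (skeletonWeight a s X Y) = 2 * genFun (smallWeight a) *
      genFun (skeletonWeight a s (Function.update X [] (X [] - 1)) Y) := by
  classical
  set w := skeletonWeight a s (Function.update X [] (X [] - 1)) Y with hw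
  let w₁ : PlaneTree → ℝ := fun t => match t with
    | nil => 0
    | node _ l r => smallWeight a l * w r
  let w₂ : PlaneTree → ℝ := fun t => match t with
    | nil => 0
    | node _ l r => w l * smallWeight a r
  have h : skeletonWeight a s X Y = fun t => w₁ t + w₂ t := by
    funext t
    cases t with
    | nil => simp [skeletonWeight_nil ha, w₁, w₂]
    | node c l r =>
      simp only [w₁, w₂, hw, skeletonWeight, smallWeight]
      rcases le_or_gt l.numLeaves a with hl | hl <;> rcases le_or_gt r.numLeaves a with hr | hr
      · by_cases h : a < (node () l r : PlaneTree).numLeaves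
        · rw [hasSkeleton_small_small h hl hr]
          simp [hX.ne', hl.not_gt, hr.not_gt]
        · rw [if_neg (fun h' => h h'.1)]
          simp [hl.not_gt, hr.not_gt]
      · rw [hasSkeleton_small_large ha hl hr]
        have : a < l.numLeaves + r.numLeaves := by omega
        simp [hX, hl, hr, this, hr.not_ge]
      · rw [hasSkeleton_large_small ha hl hr]
        have : a < l.numLeaves + r.numLeaves := by omega
        simp [hX, hl, hr, this, hl.not_ge]
      · rw [hasSkeleton_large_large ha hl hr]
        simp [hX.ne', hl.not_ge, hr.not_ge]
  rw [h, genFun_add, genFun_node w₁ (smallWeight a) w rfl (fun _ _ => rfl),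
    genFun_node w₂ w (smallWeight a) rfl (fun _ _ => rfl)]
  ring

/-- The trees counted are forks of two small trees with `Y []` leaves in all; `hY` makes the
requirement of more than a leaves automatic. -/
lemma genFun_skeletonWeight_nil (ha : 1 ≤ a) (hX : X [] = 0) (hY : a < Y []) :
    genFun (skeletonWeight a nil X Y) =
      PowerSeries.monomial (Y []) (PowerSeries.coeff (Y []) (genFun (smallWeight a) ^ 2)) := by
  classical
  let w : PlaneTree → ℝ := fun t => match t with
    | nil => 0
    | node _ l r => smallWeight a l * smallWeight a r
  have h : ∀ t, skeletonWeight a nil X Y t = if t.numLeaves = Y [] then w t else 0 := by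
    intro t
    cases t with
    | nil => rw [skeletonWeight_nil ha]; split_ifs <;> rfl
    | node c l r =>
      simp only [w, skeletonWeight, smallWeight]
      rcases le_or_gt l.numLeaves a with hl | hl <;> rcases le_or_gt r.numLeaves a with hr | hr
      · by_cases h : a < (node () l r : PlaneTree).numLeaves
        · rw [hasSkeleton_small_small h hl hr]
          simp only [numLeaves] at h
          simp [hX, hl, hr, h]
        · rw [if_neg (fun h' => h h'.1), if_neg]
          simp only [numLeaves] at h ⊢
          omega
      · rw [hasSkeleton_small_large ha hl hr]
        simp [hX, hr.not_ge]
      · rw [hasSkeleton_large_small ha hl hr]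
        simp [hX, hl.not_ge]
      · rw [hasSkeleton_large_large ha hl hr]
        simp [hl.not_ge]
  rw [pow_two, ← genFun_node w (smallWeight a) (smallWeight a) rfl (fun _ _ => rfl)]
  ext n
  rw [PowerSeries.coeff_monomial]
  simp only [genFun, PowerSeries.coeff_mk, h]
  split_ifs with hn
  · subst hn
    exact Finset.sum_congr rfl fun t ht => by rw [if_pos (mem_treesOfSize.1 ht)]
  · exact Finset.sum_eq_zero fun t ht => by rw [if_neg]; rw [mem_treesOfSize.1 ht]; exact hn

lemma genFun_skeletonWeight_node (ha : 1 ≤ a) (hX : X [] = 0) (s₁ s₂ : PlaneTree) :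
    genFun (skeletonWeight a (node () s₁ s₂) X Y) =
      genFun (skeletonWeight a s₁ (fun u => X (false :: u)) (fun u => Y (false :: u))) *
      genFun (skeletonWeight a s₂ (fun u => X (true :: u)) (fun u => Y (true :: u))) := by
  classical
  refine genFun_node _ _ _ (skeletonWeight_nil ha) fun l r => ?_
  simp only [skeletonWeight]
  rcases le_or_gt l.numLeaves a with hl | hl <;> rcases le_or_gt r.numLeaves a with hr | hr
  · by_cases h : a < (node () l r : PlaneTree).numLeaves
    · rw [hasSkeleton_small_small h hl hr]
      simp [hl.not_gt]
    · rw [if_neg (fun h' => h h'.1)]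
      simp [hl.not_gt]
  · rw [hasSkeleton_small_large ha hl hr]
    simp [hX, hl.not_gt]
  · rw [hasSkeleton_large_small ha hl hr]
    simp [hX, hr.not_gt]
  · rw [hasSkeleton_large_large ha hl hr]
    have : a < l.numLeaves + r.numLeaves := by omega
    simp only [numLeaves, this, hl, hr, true_and, node.injEq, hX]
    by_cases h₁ : HasSkeleton a s₁ (fun u => X (false :: u)) (fun u => Y (false :: u)) l <;>
    by_cases h₂ : HasSkeleton a s₂ (fun u => X (true :: u)) (fun u => Y (true :: u)) r
    · rw [if_pos ⟨s₁, s₂, ⟨rfl, rfl⟩, h₁, h₂⟩, if_pos h₁, if_pos h₂, one_mul]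
    all_goals
      rw [if_neg]
      · simp [h₁, h₂]
      · rintro ⟨_, _, ⟨rfl, rfl⟩, h₃, h₄⟩
        tauto

/-- Induction on the shape, and inside it on the root label: chain vertices are peeled off until the
label is 0, and then the root is a fork or a branch point. -/
theorem genFun_skeletonWeight (ha : 1 ≤ a) (s : PlaneTree) (X Y : Word → ℕ)
    (hY : ∀ v ∈ leaves s, a < Y v) :
    genFun (skeletonWeight a s X Y) =
      (2 * genFun (smallWeight a)) ^ (∑ u ∈ verts s, X u) *
        ∏ v ∈ leaves s, PowerSeries.monomial (Y v)
          (PowerSeries.coeff (Y v) (genFun (smallWeight a) ^ 2)) := by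
  induction s generalizing X Y with
  | nil =>
    obtain ⟨k, hk⟩ : ∃ k, X [] = k := ⟨_, rfl⟩
    induction k generalizing X with
    | zero =>
      rw [genFun_skeletonWeight_nil ha hk (hY [] (by simp [leaves]))]
      simp [verts, leaves, hk]
    | succ k ih =>
      rw [genFun_skeletonWeight_of_pos ha (by omega), ih _ (by simp [hk])]
      simp only [verts, leaves, Finset.sum_singleton, Finset.prod_singleton,
        Function.update_self, hk, Nat.add_sub_cancel]
      ring
  | node c s₁ s₂ h₁ h₂ =>
    obtain ⟨⟩ := c
    obtain ⟨k, hk⟩ : ∃ k, X [] = k := ⟨_, rfl⟩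
    induction k generalizing X with
    | zero =>
      rw [genFun_skeletonWeight_node ha hk, h₁ _ _ fun v hv => hY _ (by simp [leaves, hv]),
        h₂ _ _ fun v hv => hY _ (by simp [leaves, hv]), sum_verts_node, prod_leaves_node, hk]
      ring
    | succ k ih =>
      rw [genFun_skeletonWeight_of_pos ha (by omega), ih _ (by simp [hk])]
      simp only [sum_verts_node, Function.update_self, hk, Nat.add_sub_cancel, ne_eq,
        reduceCtorEq, not_false_eq_true, Function.update_of_ne]
      ring

lemma coeff_genFun_skeletonWeight (ha : 1 ≤ a) (s : PlaneTree) (X Y : Word → ℕ)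
    (hY : ∀ v ∈ leaves s, a < Y v) (n : ℕ) :
    PowerSeries.coeff n (genFun (skeletonWeight a s X Y)) =
      (∏ v ∈ leaves s, PowerSeries.coeff (Y v) (genFun (smallWeight a) ^ 2)) *
      if ∑ v ∈ leaves s, Y v ≤ n then
        PowerSeries.coeff (n - ∑ v ∈ leaves s, Y v)
          ((2 * genFun (smallWeight a)) ^ (∑ u ∈ verts s, X u))
      else 0 := by
  have : ∏ v ∈ leaves s, PowerSeries.monomial (Y v)
      (PowerSeries.coeff (Y v) (genFun (smallWeight a) ^ 2)) =
      PowerSeries.C (∏ v ∈ leaves s, PowerSeries.coeff (Y v) (genFun (smallWeight a) ^ 2)) *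
        PowerSeries.X ^ (∑ v ∈ leaves s, Y v) := by
    simp_rw [PowerSeries.monomial_eq_C_mul_X_pow]
    rw [Finset.prod_mul_distrib, Finset.prod_pow_eq_pow_sum, map_prod]
  rw [genFun_skeletonWeight ha s X Y hY, this, mul_left_comm, PowerSeries.coeff_C_mul,
    PowerSeries.coeff_mul_X_pow']

/-- Labels defined on all words make the recursion above free of dependent types; this is the
passage back to the labels of a `Skeleton`. -/
lemma skeleton_eq_iff (s : PlaneTree) (x : s.verts → ℕ) (y : s.leaves → ℕ) (X Y : Word → ℕ)
    (hX : ∀ u, X (u : s.verts) = x u) (hY : ∀ v, Y (v : s.leaves) = y v) (t : PlaneTree) :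
    skeleton a t = ⟨s, x, y⟩ ↔ HasSkeleton a s X Y t := by
  constructor
  · intro h
    rw [skeleton, Skeleton.mk.injEq] at h
    obtain ⟨rfl, hx, hy⟩ := h
    rw [heq_iff_eq] at hx hy
    refine ⟨rfl, fun u hu => ?_, fun v hv => ?_⟩
    · rw [hX ⟨u, hu⟩, ← hx]
    · rw [hY ⟨v, hv⟩, ← hy]
  · rintro ⟨rfl, hx, hy⟩
    rw [skeleton, Skeleton.mk.injEq]
    refine ⟨rfl, heq_of_eq (funext fun u => ?_), heq_of_eq (funext fun v => ?_)⟩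
    · rw [← hX, hx _ u.2]
    · rw [← hY, hy _ v.2]

lemma ncard_skeleton {n : ℕ} (hn : a < n) (x : s.verts → ℕ) (y : s.leaves → ℕ)
    (hX : ∀ u, X (u : s.verts) = x u) (hY : ∀ v, Y (v : s.leaves) = y v) :
    ((ofSize n ∩ {t | skeleton a t = ⟨s, x, y⟩}).ncard : ℝ) =
      PowerSeries.coeff n (genFun (skeletonWeight a s X Y)) := by
  classical
  rw [ncard_ofSize_inter, genFun, PowerSeries.coeff_mk, Finset.card_filter, Nat.cast_sum]
  refine Finset.sum_congr rfl fun t ht => ?_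
  rw [mem_treesOfSize] at ht
  simp only [Set.mem_ofPred_eq, skeleton_eq_iff s x y X Y hX hY, skeletonWeight, ht, hn, true_and]
  push_cast
  rfl

/-- The probability that the skeleton is a given one, in terms of generating functions. -/
theorem uniformProb_skeleton (ha : 1 ≤ a) {n : ℕ} (hn : a < n) (s : PlaneTree)
    (x : s.verts → ℕ) (y : s.leaves → ℕ) (hy : ∀ v, a < y v) :
    uniformProb n {t | skeleton a t = ⟨s, x, y⟩} =
      ((∏ v, PowerSeries.coeff (y v) (genFun (smallWeight a) ^ 2)) *
      if ∑ v, y v ≤ n then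
        PowerSeries.coeff (n - ∑ v, y v) ((2 * genFun (smallWeight a)) ^ (∑ u, x u))
      else 0) / catalan (n - 1) := by
  obtain ⟨X, hX⟩ : ∃ X : Word → ℕ, ∀ u, X (u : s.verts) = x u :=
    ⟨fun u => if h : u ∈ s.verts then x ⟨u, h⟩ else 0, fun u => by simp⟩
  obtain ⟨Y, hY⟩ : ∃ Y : Word → ℕ, ∀ v, Y (v : s.leaves) = y v :=
    ⟨fun u => if h : u ∈ s.leaves then y ⟨u, h⟩ else 0, fun u => by simp⟩
  have h := coeff_genFun_skeletonWeight ha s X Y (fun v hv => by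
    rw [hY ⟨v, hv⟩]; exact hy _) n
  have e₁ : ∑ u ∈ verts s, X u = ∑ u, x u := by
    rw [← Finset.sum_coe_sort]; exact Finset.sum_congr rfl fun u _ => hX u
  have e₂ : ∑ u ∈ leaves s, Y u = ∑ u, y u := by
    rw [← Finset.sum_coe_sort]; exact Finset.sum_congr rfl fun u _ => hY u
  have e₃ : ∏ v ∈ leaves s, PowerSeries.coeff (Y v) (genFun (smallWeight a) ^ 2) =
      ∏ v, PowerSeries.coeff (y v) (genFun (smallWeight a) ^ 2) := by
    rw [← Finset.prod_coe_sort]; exact Finset.prod_congr rfl fun u _ => by rw [hY]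
  rw [e₁, e₂, e₃] at h
  rw [← h, uniformProb, ncard_skeleton hn x y hX hY]
  obtain ⟨k, rfl⟩ : ∃ k, n = k + 1 := ⟨n - 1, by omega⟩
  rw [ncard_ofSize_succ, Nat.add_sub_cancel]

end PlaneTree

/-! ### Powers of the Catalan series, the step law and inclusion-exclusion -/

namespace PlaneTree

open BinaryTree

lemma catalanSeries_pow_succ_succ (m : ℕ) :
    PowerSeries.catalanSeries ^ (m + 1) =
      PowerSeries.catalanSeries ^ m + PowerSeries.X * PowerSeries.catalanSeries ^ (m + 2) := by
  have h := PowerSeries.catalanSeries_sq_mul_X_add_one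
  calc _ = PowerSeries.catalanSeries ^ m * PowerSeries.catalanSeries := pow_succ _ _
    _ = PowerSeries.catalanSeries ^ m * (PowerSeries.catalanSeries ^ 2 * PowerSeries.X + 1) := by
      rw [h]
    _ = _ := by ring

/-- The coefficients of the powers of the Catalan series. -/
theorem coeff_catalanSeries_pow (m n : ℕ) :
    (2 * n + m) * PowerSeries.coeff n (PowerSeries.catalanSeries ^ m) =
      m * (2 * n + m).choose n := by
  induction n generalizing m with
  | zero =>
    simp [PowerSeries.catalanSeries_constantCoeff]
  | succ n ihn =>
    induction m with
    | zero => simp [PowerSeries.coeff_one]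
    | succ m ihm =>
      rw [catalanSeries_pow_succ_succ, map_add, PowerSeries.coeff_succ_X_mul]
      have h₁ := ihm
      have h₂ := ihn (m + 2)
      set u := PowerSeries.coeff (n + 1) (PowerSeries.catalanSeries ^ m)
      set v := PowerSeries.coeff n (PowerSeries.catalanSeries ^ (m + 2))
      have e₁ : 2 * (n + 1) + m = 2 * n + m + 2 := by ring
      have e₂ : 2 * n + (m + 2) = 2 * n + m + 2 := by ring
      have e₃ : 2 * (n + 1) + (m + 1) = 2 * n + m + 2 + 1 := by ring
      rw [e₁] at h₁
      rw [e₂] at h₂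
      rw [e₃, Nat.choose_succ_succ]
      have h₃ := Nat.choose_succ_right_eq (2 * n + m + 2) n
      rw [show 2 * n + m + 2 - n = n + m + 2 by omega] at h₃
      set b := (2 * n + m + 2).choose n
      set c := (2 * n + m + 2).choose (n + 1)
      -- Both induction hypotheses carry this same factor and the same row of Pascal's triangle, so
      -- after multiplying the goal by it only the ratio `h₃` of adjacent entries is needed.
      have hK : (2 * (n : ℤ) + m + 2) ≠ 0 := by positivity
      zify at h₁ h₂ h₃ ⊢
      apply mul_left_cancel₀ hK
      linear_combination (2 * (n : ℤ) + m + 3) * (h₁ + h₂) - 2 * h₃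

/-- The offspring law: `stepProb p` is the probability that a critical binary Galton-Watson tree
has `p` leaves. -/
noncomputable def stepProb : ℕ → ℝ
  | 0 => 0
  | p + 1 => 2 * catalan p / 4 ^ (p + 1)

lemma stepProb_nonneg (p : ℕ) : 0 ≤ stepProb p := by
  cases p with
  | zero => exact le_rfl
  | succ p => rw [stepProb]; positivity

/-- The generating function of `stepProb`. -/
noncomputable def stepSeries : PowerSeries ℝ := PowerSeries.mk stepProb

/-- The generating function of the restriction of `stepProb` to `p > a`. -/
noncomputable def tailSeries (a : ℕ) : PowerSeries ℝ :=
  PowerSeries.mk fun p => if a < p then stepProb p else 0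

lemma stepSeries_eq : stepSeries =
    PowerSeries.C (1 / 2) * (PowerSeries.X * PowerSeries.rescale (1 / 4 : ℝ)
      (PowerSeries.map (Nat.castRingHom ℝ) PowerSeries.catalanSeries)) := by
  ext p
  rw [PowerSeries.coeff_C_mul, stepSeries, PowerSeries.coeff_mk]
  cases p with
  | zero => simp [stepProb]
  | succ p =>
    rw [PowerSeries.coeff_succ_X_mul, PowerSeries.coeff_rescale, PowerSeries.coeff_map,
      PowerSeries.catalanSeries_coeff, stepProb]
    simp only [eq_natCast, one_div, inv_pow, pow_succ]
    ring

/-- The law of a sum of `m` independent steps. -/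
theorem coeff_stepSeries_pow (m n : ℕ) :
    (2 * n + m : ℝ) * PowerSeries.coeff (n + m) (stepSeries ^ m) =
      m * ((2 * n + m).choose n : ℝ) / 2 ^ (2 * n + m) := by
  have h : (2 * n + m : ℝ) * PowerSeries.coeff n (PowerSeries.catalanSeries ^ m) =
      m * (2 * n + m).choose n := mod_cast coeff_catalanSeries_pow m n
  rw [stepSeries_eq, mul_pow, mul_pow, ← map_pow, ← map_pow, ← map_pow, PowerSeries.coeff_C_mul,
    PowerSeries.coeff_X_pow_mul, PowerSeries.coeff_rescale, PowerSeries.coeff_map, eq_natCast,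
    pow_add, pow_mul, show (2 : ℝ) ^ 2 = 4 by norm_num, ← h]
  simp only [one_div, inv_pow]
  field_simp

lemma coeff_stepSeries_pow_of_lt {m N : ℕ} (h : N < m) :
    PowerSeries.coeff N (stepSeries ^ m) = 0 := by
  rw [stepSeries_eq, mul_pow, mul_pow, ← map_pow, PowerSeries.coeff_C_mul,
    PowerSeries.coeff_X_pow_mul', if_neg h.not_ge, mul_zero]

/-- There are `catalan (p - 1)` trees with p ≥ 1 leaves, which is 4^p / 2 times `stepProb p`. -/
lemma two_mul_genFun_smallWeight (a : ℕ) :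
    2 * genFun (smallWeight a) = PowerSeries.rescale 4 (stepSeries - tailSeries a) := by
  ext p
  rw [PowerSeries.coeff_rescale, map_sub, stepSeries, tailSeries, PowerSeries.coeff_mk,
    PowerSeries.coeff_mk,
    show (2 : PowerSeries ℝ) = PowerSeries.C 2 from (map_ofNat PowerSeries.C 2).symm,
    PowerSeries.coeff_C_mul, genFun, PowerSeries.coeff_mk]
  have h : ∑ t ∈ treesOfSize p, smallWeight a t =
      if a < p then 0 else ((treesOfSize p).card : ℝ) := by
    split_ifs with hp
    · exact Finset.sum_eq_zero fun t ht => by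
        rw [mem_treesOfSize] at ht; rw [smallWeight, if_neg]; omega
    · rw [← nsmul_one, ← Finset.sum_const]
      exact Finset.sum_congr rfl fun t ht => by
        rw [mem_treesOfSize] at ht; rw [smallWeight, if_pos]; omega
  rw [h]
  cases p with
  | zero => simp [treesOfSize, stepProb]
  | succ p =>
    rw [card_treesOfSize_succ, stepProb]
    split_ifs with hp
    · simp
    · field_simp
      ring

lemma coeff_genFun_smallWeight_sq (a y : ℕ) :
    PowerSeries.coeff y (genFun (smallWeight a) ^ 2) =
      4 ^ y / 4 * PowerSeries.coeff y ((stepSeries - tailSeries a) ^ 2) := by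
  have h : genFun (smallWeight a) ^ 2 =
      PowerSeries.C (1 / 4) * PowerSeries.rescale 4 ((stepSeries - tailSeries a) ^ 2) := by
    rw [map_pow, ← two_mul_genFun_smallWeight, mul_pow,
      show (2 : PowerSeries ℝ) = PowerSeries.C 2 from (map_ofNat PowerSeries.C 2).symm,
      ← map_pow, ← mul_assoc, ← map_mul]
    norm_num
  rw [h, PowerSeries.coeff_C_mul, PowerSeries.coeff_rescale]
  ring

/-- The coefficient at an integer, which is zero at the negative integers. -/
noncomputable def intCoeff (f : PowerSeries ℝ) (N : ℤ) : ℝ :=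
  if 0 ≤ N then PowerSeries.coeff N.toNat f else 0

lemma intCoeff_of_neg (f : PowerSeries ℝ) {N : ℤ} (h : N < 0) : intCoeff f N = 0 :=
  if_neg h.not_ge

lemma intCoeff_natCast (f : PowerSeries ℝ) (N : ℕ) :
    intCoeff f N = PowerSeries.coeff N f := by
  simp [intCoeff]

/-- The forks contribute 4^|y| and the chains 4^(n - |y|), which cancel the 4^n in `catalan (n -
1)`. A factor 1/4 per fork and one factor 2 survive. The convention of `intCoeff` covers the case
|y| > n. -/
lemma uniformProb_skeleton_eq_stepProb {a : ℕ} (ha : 1 ≤ a) {n : ℕ} (hn : a < n) (s : PlaneTree)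
    (x : s.verts → ℕ) (y : s.leaves → ℕ) (hy : ∀ v, a < y v) :
    uniformProb n {t | skeleton a t = ⟨s, x, y⟩} =
      2 / 4 ^ s.numLeaves * (∏ v, PowerSeries.coeff (y v) ((stepSeries - tailSeries a) ^ 2)) *
        intCoeff ((stepSeries - tailSeries a) ^ (∑ u, x u)) ((n : ℤ) - (∑ v, y v : ℕ)) /
          stepProb n := by
  rw [uniformProb_skeleton ha hn s x y hy]
  set Y := ∑ v, y v with hYdef
  have hprod : ∏ v, PowerSeries.coeff (y v) (genFun (smallWeight a) ^ 2) =
      4 ^ Y / 4 ^ s.numLeaves *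
        ∏ v, PowerSeries.coeff (y v) ((stepSeries - tailSeries a) ^ 2) := by
    simp_rw [coeff_genFun_smallWeight_sq, div_eq_mul_inv]
    rw [Finset.prod_mul_distrib, Finset.prod_mul_distrib, Finset.prod_pow_eq_pow_sum]
    simp [card_leaves, Y]
  rw [hprod]
  obtain ⟨k, rfl⟩ : ∃ k, n = k + 1 := ⟨n - 1, by omega⟩
  have hcat : (catalan k : ℝ) ≠ 0 := by
    have := succ_mul_catalan_eq_centralBinom k
    have h₂ := Nat.centralBinom_pos k
    rw [← this] at h₂
    exact_mod_cast (Nat.pos_of_mul_pos_left h₂).ne'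
  split_ifs with h
  · obtain ⟨N, hN⟩ : ∃ N, k + 1 = Y + N := ⟨k + 1 - Y, by omega⟩
    have e : ((k + 1 : ℕ) : ℤ) - (Y : ℤ) = (N : ℕ) := by omega
    rw [e, intCoeff_natCast, show k + 1 - Y = N by omega, two_mul_genFun_smallWeight, ← map_pow,
      PowerSeries.coeff_rescale, stepProb, Nat.add_sub_cancel, hN, pow_add]
    field_simp
  · rw [intCoeff_of_neg _ (by omega)]
    simp

lemma coeff_tailSeries_pow_mul (a k : ℕ) (f : PowerSeries ℝ) {N : ℕ} (h : N < k * (a + 1)) :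
    PowerSeries.coeff N (tailSeries a ^ k * f) = 0 := by
  have h₁ : PowerSeries.X ^ (a + 1) ∣ tailSeries a := by
    rw [PowerSeries.X_pow_dvd_iff]
    intro m hm
    rw [tailSeries, PowerSeries.coeff_mk, if_neg (by omega)]
  have h₂ : PowerSeries.X ^ (k * (a + 1)) ∣ tailSeries a ^ k * f := by
    rw [mul_comm k, pow_mul]
    exact (pow_dvd_pow_of_dvd h₁ k).mul_right f
  exact PowerSeries.X_pow_dvd_iff.1 h₂ N h

/-- The generating function, at an integer, of sums of `m + k` steps of which the first `k` are
larger than `a`. -/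
noncomputable def tailProb (a k m : ℕ) (N : ℤ) : ℝ :=
  intCoeff (tailSeries a ^ k * stepSeries ^ m) N

/-- Inclusion-exclusion over the steps that are larger than `a`. -/
theorem intCoeff_sub_pow (a m K : ℕ) {N : ℤ} (h : N < K * (a + 1)) :
    intCoeff ((stepSeries - tailSeries a) ^ m) N =
      ∑ k ∈ Finset.range K, (-1) ^ k * (m.choose k : ℝ) * tailProb a k (m - k) N := by
  rcases lt_or_ge N 0 with hN | hN
  · rw [intCoeff_of_neg _ hN]
    exact (Finset.sum_eq_zero fun k _ => by rw [tailProb, intCoeff_of_neg _ hN, mul_zero]).symm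
  lift N to ℕ using hN
  simp_rw [tailProb, intCoeff_natCast]
  set f : ℕ → ℝ := fun k => (-1) ^ k * (m.choose k : ℝ) *
    PowerSeries.coeff N (tailSeries a ^ k * stepSeries ^ (m - k)) with hf
  have h₁ : PowerSeries.coeff N ((stepSeries - tailSeries a) ^ m) =
      ∑ k ∈ Finset.range (m + 1), f k := by
    rw [show stepSeries - tailSeries a = -tailSeries a + stepSeries by ring, add_pow, map_sum]
    refine Finset.sum_congr rfl fun k _ => ?_
    rw [hf, neg_pow, ← map_natCast PowerSeries.C, mul_comm _ (PowerSeries.C _),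
      PowerSeries.coeff_C_mul, show (-1 : PowerSeries ℝ) ^ k = PowerSeries.C ((-1) ^ k) by simp,
      mul_assoc, PowerSeries.coeff_C_mul]
    ring
  -- Here K steps larger than a already exceed N.
  have h₂ : ∀ k, K ≤ k → f k = 0 := fun k hk => by
    rw [hf]
    dsimp only
    rw [coeff_tailSeries_pow_mul, mul_zero]
    have h' : N < K * (a + 1) := by exact_mod_cast h
    exact h'.trans_le (Nat.mul_le_mul_right _ hk)
  -- For k > m the binomial coefficient vanishes, so the truncated difference `m - k` is harmless.
  have h₃ : ∀ k, m + 1 ≤ k → f k = 0 := fun k hk => by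
    rw [hf]
    dsimp only
    rw [Nat.choose_eq_zero_of_lt (by omega)]
    simp
  rw [h₁]
  rcases le_total K (m + 1) with hle | hle
  · exact (Finset.sum_subset (Finset.range_subset_range.2 hle) fun k _ hk =>
      h₂ k (by simpa using hk)).symm
  · exact Finset.sum_subset (Finset.range_subset_range.2 hle) fun k _ hk =>
      h₃ k (by simpa using hk)

/-- Vanishing at negative integers lets the range depend only on an upper bound for N, as needed to
compare with integrals over a fixed interval. -/
lemma intCoeff_mul (f g : PowerSeries ℝ) {N : ℤ} {n : ℕ} (h : N ≤ n) :
    intCoeff (f * g) N =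
      ∑ j ∈ Finset.range (n + 1), PowerSeries.coeff j f * intCoeff g (N - j) := by
  rcases lt_or_ge N 0 with hN | hN
  · rw [intCoeff_of_neg _ hN]
    exact (Finset.sum_eq_zero fun k _ => by rw [intCoeff_of_neg _ (by omega), mul_zero]).symm
  lift N to ℕ using hN
  rw [intCoeff_natCast, PowerSeries.coeff_mul,
    Finset.Nat.sum_antidiagonal_eq_sum_range_succ_mk]
  rw [← Finset.sum_subset (Finset.range_subset_range.2 (show N + 1 ≤ n + 1 by omega))]
  · refine Finset.sum_congr rfl fun j hj => ?_
    rw [Finset.mem_range] at hj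
    rw [← Nat.cast_sub (by omega), intCoeff_natCast]
  · intro j _ hj
    rw [Finset.mem_range] at hj
    rw [intCoeff_of_neg _ (by omega), mul_zero]

/-- Decomposition according to the size `a + 1 + i` of one large step: the discrete form of the
recursion that defines `tailDensity`. -/
lemma tailProb_succ (a k m : ℕ) {N : ℤ} {n : ℕ} (h : N ≤ n) :
    tailProb a (k + 1) m N =
      ∑ i ∈ Finset.range n, stepProb (a + 1 + i) * tailProb a k m (N - (a + 1 + i : ℕ)) := by
  rw [tailProb, pow_succ', mul_assoc, intCoeff_mul (n := a + n) _ _ (by push_cast; omega),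
    show a + n + 1 = a + 1 + n by ring, Finset.sum_range_add, Finset.sum_eq_zero, zero_add]
  · refine Finset.sum_congr rfl fun i _ => ?_
    rw [tailSeries, PowerSeries.coeff_mk, if_pos (by omega), tailProb, tailSeries]
  · intro i hi
    rw [Finset.mem_range] at hi
    rw [tailSeries, PowerSeries.coeff_mk, if_neg (by omega), zero_mul]

lemma coeff_sub_sq {a n : ℕ} (y : ℕ) (h : a < n) :
    PowerSeries.coeff y ((stepSeries - tailSeries a) ^ 2) =
      ∑ i ∈ Finset.range n, if i ≤ a ∧ y ≤ i + a then
        stepProb i * stepProb (y - i) else 0 := by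
  have hc : ∀ p, PowerSeries.coeff p (stepSeries - tailSeries a) =
      if p ≤ a then stepProb p else 0 := fun p => by
    rw [map_sub, stepSeries, tailSeries, PowerSeries.coeff_mk, PowerSeries.coeff_mk]
    rcases le_or_gt p a with hp | hp
    · simp [hp, hp.not_gt]
    · simp [hp, hp.not_ge]
  rw [pow_two, ← intCoeff_natCast, intCoeff_mul (n := y + n) _ _ (by push_cast; omega),
    ← Finset.sum_subset (Finset.range_subset_range.2 (show n ≤ y + n + 1 by omega))
      (fun i _ hi => by
        rw [Finset.mem_range] at hi
        rw [hc, if_neg (by omega), zero_mul])]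
  refine Finset.sum_congr rfl fun i hi => ?_
  rw [hc]
  rcases le_or_gt i y with hi | hi
  · rw [← Nat.cast_sub hi, intCoeff_natCast, hc]
    have e : y - i ≤ a ↔ y ≤ i + a := by omega
    by_cases h₁ : i ≤ a <;> by_cases h₂ : y ≤ i + a <;> simp [h₁, h₂, e]
  -- When i > y the truncated difference is 0, where `stepProb` vanishes.
  · rw [intCoeff_of_neg _ (by omega), show y - i = 0 by omega]
    simp [stepProb]

end PlaneTree

/-! ### Asymptotics of binomial coefficients -/

namespace PlaneTree

open BinaryTree

/-- The relative entropy that governs binomial coefficients. -/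
noncomputable def walkEntropy (p q : ℝ) : ℝ :=
  p * Real.log (2 * p / (p + q)) + q * Real.log (2 * q / (p + q))

lemma factorial_eq_stirlingSeq {n : ℕ} (hn : n ≠ 0) :
    (n.factorial : ℝ) =
      Stirling.stirlingSeq n * (√(2 * n : ℝ) * (n / Real.exp 1) ^ n) := by
  have : (0 : ℝ) < n := by positivity
  rw [Stirling.stirlingSeq, div_mul_cancel₀]
  positivity

/-- Stirling's formula kept as an identity: the whole error sits in the ratio of `stirlingSeq`,
which can then be bounded or passed to the limit. -/
lemma choose_div_two_pow_eq {p q : ℕ} (hp : p ≠ 0) (hq : q ≠ 0) :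
    ((p + q).choose p : ℝ) / 2 ^ (p + q) =
      Stirling.stirlingSeq (p + q) / (Stirling.stirlingSeq p * Stirling.stirlingSeq q) *
        √((p + q) / (2 * p * q)) * Real.exp (-walkEntropy p q) := by
  have hp' : (0 : ℝ) < p := by positivity
  have hq' : (0 : ℝ) < q := by positivity
  have h : ((p + q).choose p : ℝ) = (p + q).factorial / (p.factorial * q.factorial) := by
    rw [eq_div_iff (by positivity), ← mul_assoc]
    have := Nat.choose_mul_factorial_mul_factorial (Nat.le_add_right p q)
    rw [Nat.add_sub_cancel_left] at this
    exact_mod_cast this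
  have hexp : Real.exp (-walkEntropy p q) =
      ((p + q) / 2 : ℝ) ^ (p + q) / (p ^ p * q ^ q) := by
    rw [walkEntropy, Real.exp_neg, Real.exp_add, Real.exp_nat_mul, Real.exp_nat_mul,
      Real.exp_log (by positivity), Real.exp_log (by positivity), pow_add, div_pow, div_pow,
      div_pow, div_pow, mul_pow, mul_pow]
    field_simp
  have hsqrt : √((p + q) / (2 * p * q)) =
      √(2 * (p + q : ℕ)) / (√(2 * p : ℝ) * √(2 * q)) := by
    rw [← Real.sqrt_mul (by positivity), ← Real.sqrt_div (by positivity)]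
    congr 1
    push_cast
    field_simp
  have hsp : Stirling.stirlingSeq p ≠ 0 :=
    (lt_of_lt_of_le (by positivity) (Stirling.sqrt_pi_le_stirlingSeq hp)).ne'
  have hsq : Stirling.stirlingSeq q ≠ 0 :=
    (lt_of_lt_of_le (by positivity) (Stirling.sqrt_pi_le_stirlingSeq hq)).ne'
  rw [h, hexp, hsqrt, factorial_eq_stirlingSeq hp, factorial_eq_stirlingSeq hq,
    factorial_eq_stirlingSeq (show p + q ≠ 0 by omega)]
  have h2p : √(2 * p : ℝ) ≠ 0 := by positivity
  have h2q : √(2 * q : ℝ) ≠ 0 := by positivity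
  have he : Real.exp 1 ≠ 0 := (Real.exp_pos 1).ne'
  push_cast
  simp only [div_pow, pow_add]
  field_simp

/-- A Chernoff bound. -/
lemma choose_div_two_pow_le_exp (p q : ℕ) :
    ((p + q).choose p : ℝ) / 2 ^ (p + q) ≤
      Real.exp (-((p - q : ℝ) ^ 2 / (2 * (p + q)))) := by
  rcases Nat.eq_zero_or_pos (p + q) with h0 | h0
  · obtain ⟨rfl, rfl⟩ : p = 0 ∧ q = 0 := by omega
    simp
  have hL : (0 : ℝ) < p + q := by exact_mod_cast h0
  -- This t minimises the exponent (p + q) t² / 2 - t (p - q).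
  set t : ℝ := (p - q) / (p + q) with ht
  have h₁ : ((p + q).choose p : ℝ) * Real.exp (t * (p - q)) ≤ (2 * Real.cosh t) ^ (p + q) := by
    rw [Real.cosh_eq, mul_div_cancel₀ _ two_ne_zero, add_pow]
    refine le_trans (le_of_eq ?_) (Finset.single_le_sum (f := fun k =>
      Real.exp t ^ k * Real.exp (-t) ^ (p + q - k) * ((p + q).choose k : ℝ))
      (fun k _ => by positivity) (Finset.mem_range.2 (show p < p + q + 1 by omega)))
    rw [Nat.add_sub_cancel_left, ← Real.exp_nat_mul, ← Real.exp_nat_mul, ← Real.exp_add, mul_comm]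
    congr 2
    ring
  have h₂ : Real.cosh t ^ (p + q) ≤ Real.exp ((p + q) * (t ^ 2 / 2)) := by
    calc _ ≤ Real.exp (t ^ 2 / 2) ^ (p + q) :=
          pow_le_pow_left₀ (Real.cosh_pos t).le (Real.cosh_le_exp_half_sq t) _
      _ = _ := by rw [← Real.exp_nat_mul]; push_cast; rfl
  rw [mul_pow] at h₁
  have h₃ : -((p - q : ℝ) ^ 2 / (2 * (p + q))) = (p + q) * (t ^ 2 / 2) - t * (p - q) := by
    rw [ht]; field_simp; ring
  rw [h₃, Real.exp_sub, div_le_div_iff₀ (by positivity) (by positivity)]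
  calc _ ≤ 2 ^ (p + q) * Real.cosh t ^ (p + q) := h₁
    _ ≤ 2 ^ (p + q) * Real.exp ((p + q) * (t ^ 2 / 2)) := by gcongr
    _ = _ := mul_comm _ _

/-- Gibbs' inequality against the tilted weights e^t / cosh t and e^(-t) / cosh t with t = (p -
q)/(p + q), followed by cosh t ≤ exp(t²/2). -/
lemma le_walkEntropy {p q : ℝ} (hp : 0 < p) (hq : 0 < q) :
    (p - q) ^ 2 / (2 * (p + q)) ≤ walkEntropy p q := by
  set t : ℝ := (p - q) / (p + q) with ht
  set c := Real.cosh t with hc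
  have hc0 : 0 < c := Real.cosh_pos t
  have hlogc : Real.log c ≤ t ^ 2 / 2 := by
    rw [Real.log_le_iff_le_exp hc0]; exact Real.cosh_le_exp_half_sq t
  have key : ∀ {x y : ℝ}, 0 < x → 0 < y →
      x * Real.log y + x - y * ((p + q) / 2) ≤ x * Real.log (2 * x / (p + q)) := by
    intro x y hx hy
    have hz : 0 < 2 * x / (p + q) / y := by positivity
    have h := Real.one_sub_inv_le_log_of_pos hz
    rw [Real.log_div (by positivity) hy.ne'] at h
    have h' := mul_le_mul_of_nonneg_left h hx.le
    have e : x * (1 - (2 * x / (p + q) / y)⁻¹) = x - y * ((p + q) / 2) := by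
      field_simp
    rw [e] at h'
    linarith
  have h₁ := key hp (show 0 < Real.exp t / c by positivity)
  have h₂ := key hq (show 0 < Real.exp (-t) / c by positivity)
  rw [Real.log_div (by positivity) hc0.ne', Real.log_exp] at h₁ h₂
  have h₃ : Real.exp t / c * ((p + q) / 2) + Real.exp (-t) / c * ((p + q) / 2) = p + q := by
    have : Real.exp t + Real.exp (-t) = 2 * c := by rw [hc, Real.cosh_eq]; ring
    field_simp
    linear_combination this
  have h₄ : (p + q) * Real.log c ≤ (p + q) * (t ^ 2 / 2) := by gcongr
  have h₅ : (p - q) ^ 2 / (2 * (p + q)) = (p - q) * t - (p + q) * (t ^ 2 / 2) := by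
    rw [ht]; field_simp; ring
  rw [h₅, walkEntropy]
  linarith

/-- The entropy is (p + q)/2 times (1 + t) log(1 + t) + (1 - t) log(1 - t), with t = (p - q)/(p +
q). Since log(1 + t) + log(1 - t) = log(1 - t²), this has an explicit factor t², and knowing log(1 +
x) = x k(x) with k continuous at 0 and k(0) = 1 is enough. -/
lemma tendsto_walkEntropy {ι : Type*} {l : Filter ι} {p q : ι → ℝ} {c : ℝ}
    (hp : ∀ᶠ i in l, 0 < p i) (hq : ∀ᶠ i in l, 0 < q i)
    (hpq : Tendsto (fun i => (p i - q i) / (p i + q i)) l (𝓝 0))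
    (hc : Tendsto (fun i => (p i - q i) ^ 2 / (p i + q i)) l (𝓝 c)) :
    Tendsto (fun i => walkEntropy (p i) (q i)) l (𝓝 (c / 2)) := by
  set k : ℝ → ℝ := fun x => dslope Real.log 1 (1 + x) with hk
  have hk0 : Tendsto k (𝓝 0) (𝓝 1) := by
    have h₁ : ContinuousAt (dslope Real.log 1) 1 :=
      continuousAt_dslope_same.2 (Real.differentiableAt_log one_ne_zero)
    have h₂ : Tendsto (fun x : ℝ => 1 + x) (𝓝 0) (𝓝 1) := by
      have : ContinuousAt (fun x : ℝ => 1 + x) 0 := by fun_prop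
      simpa [ContinuousAt] using this
    have h₃ := h₁.tendsto.comp h₂
    rwa [dslope_same, Real.deriv_log, inv_one] at h₃
  have hlog : ∀ x : ℝ, Real.log (1 + x) = x * k x := fun x => by
    have := sub_smul_dslope Real.log 1 (1 + x)
    simpa using this.symm
  set t : ι → ℝ := fun i => (p i - q i) / (p i + q i) with ht
  set b : ι → ℝ := fun i => (p i - q i) ^ 2 / (p i + q i) with hb
  have hk₁ : Tendsto (fun i => k (t i)) l (𝓝 1) := hk0.comp hpq
  have hk₂ : Tendsto (fun i => k (-t i)) l (𝓝 1) :=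
    hk0.comp (by simpa using hpq.neg)
  have hk₃ : Tendsto (fun i => k (-(t i ^ 2))) l (𝓝 1) :=
    hk0.comp (by simpa using (hpq.pow 2).neg)
  have main : Tendsto (fun i => -(b i * k (-(t i ^ 2))) / 2 +
      b i * (k (t i) + k (-t i)) / 2) l (𝓝 (-(c * 1) / 2 + c * (1 + 1) / 2)) :=
    ((hc.mul hk₃).neg.div_const 2).add ((hc.mul (hk₁.add hk₂)).div_const 2)
  rw [show -(c * 1) / 2 + c * (1 + 1) / 2 = c / 2 by ring] at main
  refine main.congr' ?_
  filter_upwards [hp, hq] with i hpi hqi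
  have hs : 0 < p i + q i := by positivity
  have e₁ : 2 * p i / (p i + q i) = 1 + t i := by rw [ht]; field_simp; ring
  have e₂ : 2 * q i / (p i + q i) = 1 + -t i := by rw [ht]; field_simp; ring
  have e₃ : k (-(t i ^ 2)) * (-(t i ^ 2)) = t i * k (t i) + -t i * k (-t i) := by
    have h1 : 0 < 1 + t i := by rw [← e₁]; positivity
    have h2 : 0 < 1 + -t i := by rw [← e₂]; positivity
    rw [mul_comm, ← hlog, ← hlog, ← hlog, ← Real.log_mul h1.ne' h2.ne']
    congr 1
    ring
  have e₄ : b i = (p i + q i) * t i ^ 2 := by simp only [hb, ht]; field_simp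
  have e₅ : p i - q i = (p i + q i) * t i := by simp only [ht]; field_simp
  rw [walkEntropy, e₁, e₂, hlog, hlog, e₄]
  linear_combination (p i + q i) / 2 * e₃ - (t i * k (t i) + t i * k (-t i)) / 2 * e₅

/-- The local limit theorem for simple random walk. -/
theorem tendsto_choose_div_two_pow {ι : Type*} {l : Filter ι} {p q : ι → ℕ} {c : ℝ}
    (hp : Tendsto p l atTop) (hq : Tendsto q l atTop)
    (hc : Tendsto (fun i => (p i - q i : ℝ) ^ 2 / (p i + q i)) l (𝓝 c)) :
    Tendsto (fun i => √(p i + q i) * (((p i + q i).choose (p i) : ℝ) / 2 ^ (p i + q i))) l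
      (𝓝 (√(2 / Real.pi) * Real.exp (-c / 2))) := by
  have hp0 : ∀ᶠ i in l, 0 < p i := hp.eventually_gt_atTop 0
  have hq0 : ∀ᶠ i in l, 0 < q i := hq.eventually_gt_atTop 0
  have hpq : Tendsto (fun i => p i + q i) l atTop :=
    tendsto_atTop_mono (fun i => Nat.le_add_right _ _) hp
  have hpq' : Tendsto (fun i => (p i + q i : ℝ)) l atTop := by
    have := tendsto_natCast_atTop_atTop (R := ℝ).comp hpq
    simpa [Function.comp_def] using this
  have ht2 : Tendsto (fun i => ((p i - q i : ℝ) / (p i + q i)) ^ 2) l (𝓝 0) := by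
    have := hc.mul (tendsto_inv_atTop_zero.comp hpq')
    rw [mul_zero] at this
    refine this.congr fun i => ?_
    simp only [Function.comp]
    rw [div_pow, sq (p i + q i : ℝ), div_mul_eq_div_div, div_eq_mul_inv _ (p i + q i : ℝ)]
    rw [div_eq_mul_inv _ (p i + q i : ℝ)]
  have ht : Tendsto (fun i => (p i - q i : ℝ) / (p i + q i)) l (𝓝 0) := by
    rw [tendsto_zero_iff_abs_tendsto_zero]
    have := ht2.sqrt
    simpa [Real.sqrt_sq_eq_abs, Function.comp_def] using this
  have hE := tendsto_walkEntropy (hp0.mono fun i h => by positivity)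
    (hq0.mono fun i h => by positivity) ht hc
  have hS := Stirling.tendsto_stirlingSeq_sqrt_pi
  -- This root is √(p + q) times the prefactor √((p + q)/(2pq)) of Stirling's formula.
  have hsq : Tendsto (fun i => √(2 / (1 - ((p i - q i : ℝ) / (p i + q i)) ^ 2))) l
      (𝓝 √(2 / (1 - 0))) := by
    refine (Tendsto.div tendsto_const_nhds (tendsto_const_nhds.sub ht2) ?_).sqrt
    norm_num
  have main := (((hS.comp hpq).div ((hS.comp hp).mul (hS.comp hq))
    (by positivity)).mul hsq).mul (Real.continuous_exp.continuousAt.tendsto.comp hE.neg)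
  have e : √Real.pi / (√Real.pi * √Real.pi) * √(2 / (1 - 0)) * Real.exp (-(c / 2)) =
      √(2 / Real.pi) * Real.exp (-c / 2) := by
    rw [sub_zero, div_one, Real.sqrt_div (by norm_num), neg_div]
    have : √Real.pi ≠ 0 := by positivity
    field_simp
  rw [e] at main
  refine main.congr' ?_
  filter_upwards [hp0, hq0] with i hpi hqi
  rw [choose_div_two_pow_eq hpi.ne' hqi.ne']
  have hp' : (0 : ℝ) < p i := by exact_mod_cast hpi
  have hq' : (0 : ℝ) < q i := by exact_mod_cast hqi
  have : √(2 / (1 - ((p i - q i : ℝ) / (p i + q i)) ^ 2)) =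
      √(p i + q i) * √((p i + q i) / (2 * p i * q i)) := by
    rw [← Real.sqrt_mul (by positivity)]
    congr 1
    rw [div_pow, one_sub_div (by positivity),
      show (p i + q i : ℝ) ^ 2 - (p i - q i) ^ 2 = 4 * (p i * q i) by ring]
    field_simp
    ring
  simp only [Function.comp, Pi.div_apply, this]
  ring

end PlaneTree

/-! ### Sums of independent steps: bounds and local limit theorem -/

namespace PlaneTree

open BinaryTree

lemma rpow_three_halves {x : ℝ} (hx : 0 ≤ x) : x ^ (3 / 2 : ℝ) = x * √x := by
  rw [show (3 / 2 : ℝ) = 1 + 1 / 2 by norm_num, Real.rpow_add_of_nonneg hx (by norm_num)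
    (by norm_num), Real.rpow_one, Real.sqrt_eq_rpow]

lemma exp_neg_mul_pow_le {s : ℝ} (hs : 0 ≤ s) (j : ℕ) : Real.exp (-s) * s ^ j ≤ j.factorial := by
  have h := Real.pow_div_factorial_le_exp s hs j
  rw [div_le_iff₀ (by positivity)] at h
  rw [Real.exp_neg, inv_mul_le_iff₀ (Real.exp_pos s)]
  exact h

lemma exp_neg_mul_pow_mul_sqrt_le {s : ℝ} (hs : 0 ≤ s) (j : ℕ) :
    Real.exp (-s) * (s ^ j * √s) ≤ j.factorial + (j + 1).factorial := by
  have h : √s ≤ 1 + s := by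
    rw [Real.sqrt_le_left (by positivity)]
    nlinarith
  calc Real.exp (-s) * (s ^ j * √s) ≤ Real.exp (-s) * (s ^ j * (1 + s)) := by gcongr
    _ = Real.exp (-s) * s ^ j + Real.exp (-s) * s ^ (j + 1) := by ring
    _ ≤ _ := add_le_add (exp_neg_mul_pow_le hs j) (exp_neg_mul_pow_le hs (j + 1))

/-- The hitting-time formula: a sum of m steps equals r + m with the probability that simple random
walk first hits m at time 2r + m. The binomial coefficient counts r + m up-steps and r down-steps,
whose difference is m. -/
lemma coeff_stepSeries_pow_eq (r : ℕ) {m : ℕ} (hm : m ≠ 0) :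
    PowerSeries.coeff (r + m) (stepSeries ^ m) =
      m / (2 * r + m) * (((r + m + r).choose (r + m) : ℝ) / 2 ^ (r + m + r)) := by
  have hm' : (0 : ℝ) < m := by positivity
  have h := coeff_stepSeries_pow m r
  rw [show r + m + r = 2 * r + m by ring, show r + m = 2 * r + m - r by omega,
    Nat.choose_symm (by omega), show 2 * r + m - r = r + m by omega]
  rw [eq_div_iff (by positivity)] at h
  field_simp
  linear_combination h

lemma coeff_stepSeries_pow_nonneg (m N : ℕ) : 0 ≤ PowerSeries.coeff N (stepSeries ^ m) := by
  rcases lt_or_ge N m with h | h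
  · rw [coeff_stepSeries_pow_of_lt h]
  obtain ⟨r, rfl⟩ : ∃ r, N = r + m := ⟨N - m, by omega⟩
  rcases eq_or_ne m 0 with rfl | hm
  · simp only [pow_zero, PowerSeries.coeff_one]; split_ifs <;> norm_num
  · rw [coeff_stepSeries_pow_eq r hm]; positivity

/-- For m of order √n the bound is of order N/n². It thus serves both as the uniform bound of order
1/n needed for domination and as the proof that the limit is 0 when N/n tends to 0. -/
lemma exists_coeff_stepSeries_pow_le :
    ∃ C : ℝ, 0 ≤ C ∧ ∀ m : ℕ, m ≠ 0 → ∀ N : ℕ,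
      PowerSeries.coeff N (stepSeries ^ m) ≤ C * N / m ^ 4 := by
  have hpi := Real.sqrt_pos.2 Real.pi_pos
  obtain ⟨S, hS⟩ : ∃ S, ∀ n, Stirling.stirlingSeq n ≤ S := by
    obtain ⟨S, hS⟩ := Stirling.tendsto_stirlingSeq_sqrt_pi.bddAbove_range
    exact ⟨S, fun n => hS ⟨n, rfl⟩⟩
  have hS0 : 0 ≤ S := by simpa using hS 0
  -- The factors bound, in order, the Stirling ratio, the square-root prefactor times √L, the
  -- passage from t/2 to t in t^(5/2), the quantity 2! + 3!, and L by 2N.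
  set D : ℝ := (S / Real.pi) * 2 * (4 * 2) * 8 * 2 with hD
  have hD0 : 0 ≤ D := by have := Real.pi_pos; positivity
  refine ⟨384 + D, by positivity, fun m hm N => ?_⟩
  have hm' : (0 : ℝ) < m := by positivity
  rcases lt_or_ge N m with h | h
  · rw [coeff_stepSeries_pow_of_lt h]; positivity
  obtain ⟨r, rfl⟩ : ∃ r, N = r + m := ⟨N - m, by omega⟩
  rw [coeff_stepSeries_pow_eq r hm]
  -- If 2r < m the Chernoff bound is exponentially small in m; this regime includes r = 0, where
  -- Stirling's formula is unavailable.
  rcases lt_or_ge (2 * r) m with hr | hr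
  · have hr' : (2 * r : ℝ) ≤ m := by exact_mod_cast hr.le
    have h₁ := choose_div_two_pow_le_exp (r + m) r
    have h₂ : Real.exp (-((((r + m : ℕ) : ℝ) - r) ^ 2 / (2 * ((r + m : ℕ) + r)))) ≤
        Real.exp (-(m / 4)) := by
      apply Real.exp_le_exp.2
      rw [neg_le_neg_iff, div_le_div_iff₀ (by norm_num) (by positivity)]
      push_cast
      nlinarith
    -- This gives 384 = 3! · 4³.
    have h₃ := exp_neg_mul_pow_le (show (0 : ℝ) ≤ m / 4 by positivity) 3
    have h₄ : Real.exp (-(m / 4)) ≤ 384 / m ^ 3 := by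
      rw [le_div_iff₀ (by positivity)]
      simp only [Nat.factorial] at h₃
      push_cast at h₃
      linarith
    have h₅ : (m : ℝ) / (2 * r + m) ≤ 1 := by
      rw [div_le_one (by positivity)]; linarith [Nat.cast_nonneg (α := ℝ) r]
    calc (m : ℝ) / (2 * r + m) * (((r + m + r).choose (r + m) : ℝ) / 2 ^ (r + m + r))
        ≤ 1 * (384 / m ^ 3) :=
          mul_le_mul h₅ (h₁.trans (h₂.trans h₄)) (by positivity) zero_le_one
      _ = 384 * m / m ^ 4 := by field_simp
      _ ≤ (384 + D) * (r + m : ℕ) / m ^ 4 := by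
          gcongr
          linarith
  · have hr0 : r ≠ 0 := by omega
    have hr' : (m : ℝ) ≤ 2 * r := by exact_mod_cast hr
    have hr1 : (0 : ℝ) < r := by positivity
    set L : ℝ := 2 * r + m with hL
    have hL0 : 0 < L := by positivity
    have hLe : (((r + m : ℕ) : ℝ) + r) = L := by push_cast; ring
    rw [choose_div_two_pow_eq (show r + m ≠ 0 by omega) hr0, hLe]
    have h₁ : Stirling.stirlingSeq (r + m + r) /
        (Stirling.stirlingSeq (r + m) * Stirling.stirlingSeq r) ≤ S / Real.pi := by
      rw [← Real.mul_self_sqrt Real.pi_pos.le]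
      have a₁ := Stirling.sqrt_pi_le_stirlingSeq (show r + m ≠ 0 by omega)
      have a₂ := Stirling.sqrt_pi_le_stirlingSeq hr0
      have a₃ := hS (r + m + r)
      have a₄ := hpi.le.trans a₁
      gcongr
    have h₂ : √(L / (2 * (r + m : ℕ) * r)) ≤ 2 / √L := by
      rw [show 2 / √L = √(4 / L) by
        rw [Real.sqrt_div (by norm_num), show (4 : ℝ) = 2 ^ 2 by norm_num,
          Real.sqrt_sq (by norm_num)]]
      apply Real.sqrt_le_sqrt
      rw [div_le_div_iff₀ (by positivity) hL0]
      push_cast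
      nlinarith
    set t : ℝ := m ^ 2 / L with ht
    have ht0 : 0 ≤ t := by positivity
    have h₃ : Real.exp (-walkEntropy (r + m : ℕ) r) ≤ Real.exp (-(t / 2)) := by
      apply Real.exp_le_exp.2
      have := le_walkEntropy (show (0 : ℝ) < (r + m : ℕ) by positivity) hr1
      rw [hLe] at this
      push_cast at this ⊢
      rw [show ((r : ℝ) + m - r) ^ 2 / (2 * L) = t / 2 by rw [ht]; field_simp; ring] at this
      linarith
    have h₄ := exp_neg_mul_pow_mul_sqrt_le (show 0 ≤ t / 2 by positivity) 2
    have h₅ : Real.exp (-(t / 2)) * (t ^ 2 * √t) ≤ 4 * 2 * 8 := by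
      have e : √t = √2 * √(t / 2) := by
        rw [← Real.sqrt_mul (by norm_num)]; congr 1; ring
      have h2 : √2 ≤ 2 := by rw [Real.sqrt_le_left (by norm_num)]; norm_num
      simp only [Nat.factorial] at h₄
      push_cast at h₄
      calc Real.exp (-(t / 2)) * (t ^ 2 * √t) =
            4 * √2 * (Real.exp (-(t / 2)) * ((t / 2) ^ 2 * √(t / 2))) := by rw [e]; ring
        _ ≤ 4 * 2 * 8 := by
          gcongr
          exact h₄.trans (by norm_num)
    -- The Gaussian factor exp(-t/2) absorbs t^(5/2), which trades m / L^(3/2) for L / m^4.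
    have h₆ : (m : ℝ) / L * (1 / √L) = t ^ 2 * √t * (L / m ^ 4) := by
      rw [ht, Real.sqrt_div (by positivity), Real.sqrt_sq hm'.le]
      field_simp
    have hSpi : 0 ≤ S / Real.pi := div_nonneg hS0 Real.pi_pos.le
    calc (m : ℝ) / L * (Stirling.stirlingSeq (r + m + r) /
          (Stirling.stirlingSeq (r + m) * Stirling.stirlingSeq r) *
          √(L / (2 * (r + m : ℕ) * r)) * Real.exp (-walkEntropy (r + m : ℕ) r))
        ≤ m / L * (S / Real.pi * (2 / √L) * Real.exp (-(t / 2))) := by gcongr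
      _ = S / Real.pi * 2 * (m / L * (1 / √L)) * Real.exp (-(t / 2)) := by ring
      _ = S / Real.pi * 2 * (Real.exp (-(t / 2)) * (t ^ 2 * √t)) * (L / m ^ 4) := by
          rw [h₆]; ring
      _ ≤ S / Real.pi * 2 * (4 * 2 * 8) * (L / m ^ 4) := by gcongr
      _ ≤ S / Real.pi * 2 * (4 * 2 * 8) * (2 * (r + m : ℕ) / m ^ 4) := by
          gcongr
          rw [hL]; push_cast; linarith
      _ = D * (r + m : ℕ) / m ^ 4 := by rw [hD]; ring
      _ ≤ (384 + D) * (r + m : ℕ) / m ^ 4 := by gcongr; linarith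

/-- The local limit theorem for sums of steps. -/
theorem tendsto_coeff_stepSeries_pow {ι : Type*} {l : Filter ι} {n m r : ι → ℕ} {w z : ℝ}
    (hn : Tendsto n l atTop) (hw : 0 < w) (hz : 0 < z)
    (hm : Tendsto (fun i => (m i : ℝ) / √(n i)) l (𝓝 w))
    (hr : Tendsto (fun i => (r i : ℝ) / n i) l (𝓝 z)) :
    Tendsto (fun i => (n i : ℝ) * PowerSeries.coeff (r i + m i) (stepSeries ^ m i)) l
      (𝓝 (stableDensity (z / w ^ 2) / w ^ 2)) := by
  have hn' : Tendsto (fun i => (n i : ℝ)) l atTop := tendsto_natCast_atTop_atTop.comp hn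
  have hn0 : ∀ᶠ i in l, (0 : ℝ) < n i := hn'.eventually_gt_atTop 0
  have hmn : Tendsto (fun i => (m i : ℝ) / n i) l (𝓝 0) := by
    have h := hm.mul (tendsto_inv_atTop_zero.comp (Real.tendsto_sqrt_atTop.comp hn'))
    rw [mul_zero] at h
    refine h.congr' ?_
    filter_upwards [hn0] with i hi
    simp only [Function.comp]
    rw [← div_eq_mul_inv, div_div, Real.mul_self_sqrt hi.le]
  have hL : Tendsto (fun i => (2 * r i + m i : ℝ) / n i) l (𝓝 (2 * z)) := by
    have h := (hr.const_mul 2).add hmn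
    rw [add_zero] at h
    refine h.congr fun i => ?_
    ring
  have hr' : Tendsto r l atTop := by
    have h := Tendsto.pos_mul_atTop hz hr hn'
    have h' : Tendsto (fun i => (r i : ℝ)) l atTop := h.congr' (by
      filter_upwards [hn0] with i hi
      rw [div_mul_cancel₀ _ hi.ne'])
    exact tendsto_natCast_atTop_iff.1 h'
  have hm0 : ∀ᶠ i in l, m i ≠ 0 := by
    filter_upwards [hm.eventually (lt_mem_nhds hw)] with i hi h0
    simp [h0] at hi
  have hc : Tendsto (fun i => (((r i + m i : ℕ) : ℝ) - r i) ^ 2 / ((r i + m i : ℕ) + r i)) l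
      (𝓝 (w ^ 2 / (2 * z))) := by
    refine ((hm.pow 2).div hL (by positivity)).congr' ?_
    filter_upwards [hn0] with i hi
    simp only [Pi.div_apply]
    rw [div_pow, Real.sq_sqrt hi.le, div_div_div_cancel_right₀ hi.ne']
    push_cast
    ring_nf
  have hW := tendsto_choose_div_two_pow
    (tendsto_atTop_mono (fun i => Nat.le_add_right (r i) (m i)) hr') hr' hc
  have hL' := hL.inv₀ (by positivity)
  -- With L = 2r + m, the scaled coefficient is (m/√n)(n/L)√(n/L) times √L times the binomial
  -- probability.
  have main := ((hm.mul hL').mul hL'.sqrt).mul hW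
  have e : w * (2 * z)⁻¹ * √(2 * z)⁻¹ *
      (√(2 / Real.pi) * Real.exp (-(w ^ 2 / (2 * z)) / 2)) =
      stableDensity (z / w ^ 2) / w ^ 2 := by
    rw [stableDensity, if_pos (by positivity), rpow_three_halves (by positivity),
      Real.sqrt_div hz.le, Real.sqrt_sq hw.le, Real.sqrt_inv, Real.sqrt_mul (by norm_num),
      Real.sqrt_div (by norm_num),
      show -1 / (4 * (z / w ^ 2)) = -(w ^ 2 / (2 * z)) / 2 by field_simp; norm_num]
    have := Real.sqrt_pos.2 Real.pi_pos
    have := Real.sqrt_pos.2 hz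
    field_simp
  rw [e] at main
  refine main.congr' ?_
  filter_upwards [hn0, hm0] with i hi hmi
  rw [coeff_stepSeries_pow_eq (r i) hmi]
  have hm' : (0 : ℝ) < m i := by positivity
  have hLe : (((r i + m i : ℕ) : ℝ) + r i) = 2 * r i + m i := by push_cast; ring
  rw [hLe, inv_div, Real.sqrt_div hi.le]
  have := Real.sqrt_pos.2 hi
  have h2 : (0 : ℝ) < 2 * r i + m i := by positivity
  have := Real.sqrt_pos.2 h2
  field_simp

/-- The hitting-time formula for a single step, m = 1, with r tending to infinity. -/
lemma tendsto_stepProb_mul :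
    Tendsto (fun p : ℕ => stepProb p * (p * √p)) atTop (𝓝 (1 / (2 * √Real.pi))) := by
  rw [← tendsto_add_atTop_iff_nat 1]
  have hcast : Tendsto (fun r : ℕ => (r : ℝ)) atTop atTop := tendsto_natCast_atTop_atTop
  have hL' : Tendsto (fun r : ℕ => ((r + 1 : ℕ) + r : ℝ)) atTop atTop :=
    tendsto_atTop_mono (fun r => by push_cast; linarith [Nat.cast_nonneg (α := ℝ) r]) hcast
  have hc : Tendsto (fun r : ℕ => (((r + 1 : ℕ) : ℝ) - r) ^ 2 / ((r + 1 : ℕ) + r)) atTop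
      (𝓝 0) := by
    refine (tendsto_inv_atTop_zero.comp hL').congr fun r => ?_
    simp only [Function.comp]
    push_cast
    ring
  have hW := tendsto_choose_div_two_pow (tendsto_add_atTop_nat 1) tendsto_id hc
  have hR : Tendsto (fun r : ℕ => ((r + 1 : ℕ) : ℝ) / ((r + 1 : ℕ) + r)) atTop (𝓝 (1 / 2)) := by
    have h := ((tendsto_inv_atTop_zero.comp hL').add_const 1).div_const 2
    rw [zero_add] at h
    refine h.congr fun r => ?_
    simp only [Function.comp]
    push_cast
    field_simp
    ring
  have main := (hR.mul hR.sqrt).mul hW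
  have e : 1 / 2 * √(1 / 2) * (√(2 / Real.pi) * Real.exp (-0 / 2)) = 1 / (2 * √Real.pi) := by
    rw [neg_zero, zero_div, Real.exp_zero, Real.sqrt_div (by norm_num),
      Real.sqrt_div (by norm_num), Real.sqrt_one]
    field_simp
  rw [e] at main
  refine main.congr fun r => ?_
  have h := coeff_stepSeries_pow_eq r one_ne_zero
  rw [pow_one, stepSeries, PowerSeries.coeff_mk] at h
  rw [h]
  have hLe : (((r + 1 : ℕ) : ℝ) + r) = 2 * r + (1 : ℕ) := by push_cast; ring
  have h2 : (0 : ℝ) < 2 * r + (1 : ℕ) := by positivity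
  simp only [id]
  rw [hLe, Real.sqrt_div (by positivity)]
  have := Real.sqrt_pos.2 h2
  field_simp
  push_cast
  ring

lemma tendsto_stepProb_scaled {ι : Type*} {l : Filter ι} {n j : ι → ℕ} {u : ℝ}
    (hn : Tendsto n l atTop) (hu : 0 < u)
    (hj : Tendsto (fun i => (j i : ℝ) / n i) l (𝓝 u)) :
    Tendsto (fun i => (n i : ℝ) * √(n i) * stepProb (j i)) l
      (𝓝 (1 / (2 * √Real.pi * u ^ (3 / 2 : ℝ)))) := by
  have hn' : Tendsto (fun i => (n i : ℝ)) l atTop := tendsto_natCast_atTop_atTop.comp hn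
  have hn0 : ∀ᶠ i in l, (0 : ℝ) < n i := hn'.eventually_gt_atTop 0
  have hj' : Tendsto j l atTop := by
    have h := Tendsto.pos_mul_atTop hu hj hn'
    have h' : Tendsto (fun i => (j i : ℝ)) l atTop := h.congr' (by
      filter_upwards [hn0] with i hi
      rw [div_mul_cancel₀ _ hi.ne'])
    exact tendsto_natCast_atTop_iff.1 h'
  have hi' := hj.inv₀ hu.ne'
  have main := ((tendsto_stepProb_mul.comp hj').mul hi').mul hi'.sqrt
  have e : 1 / (2 * √Real.pi) * u⁻¹ * √u⁻¹ = 1 / (2 * √Real.pi * u ^ (3 / 2 : ℝ)) := by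
    rw [rpow_three_halves hu.le, Real.sqrt_inv]
    field_simp
  rw [e] at main
  refine main.congr' ?_
  filter_upwards [hn0, hj'.eventually_gt_atTop 0] with i hi hji
  have hji' : (0 : ℝ) < j i := by exact_mod_cast hji
  simp only [Function.comp]
  rw [inv_div, Real.sqrt_div hi.le]
  have := Real.sqrt_pos.2 hji'
  field_simp

lemma exists_stepProb_scaled_le :
    ∃ C : ℝ, 0 ≤ C ∧ ∀ δ : ℝ, 0 < δ → ∀ n j : ℕ, δ * n ≤ j →
      (n : ℝ) * √n * stepProb j ≤ C / (δ * √δ) := by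
  obtain ⟨C, hC⟩ := tendsto_stepProb_mul.bddAbove_range
  have hC' : ∀ p : ℕ, stepProb p * (p * √p) ≤ C := fun p => hC ⟨p, rfl⟩
  have hC0 : 0 ≤ C := by simpa using hC' 0
  refine ⟨C, hC0, fun δ hδ n j h => ?_⟩
  have h₁ : (n : ℝ) ≤ j / δ := by rw [le_div_iff₀ hδ]; linarith
  calc (n : ℝ) * √n * stepProb j ≤ (j / δ) * √(j / δ) * stepProb j := by
        have := stepProb_nonneg j
        gcongr
    _ = stepProb j * (j * √j) / (δ * √δ) := by
        rw [Real.sqrt_div (by positivity)]; ring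
    _ ≤ C / (δ * √δ) := by gcongr; exact hC' j

end PlaneTree

/-! ### The limit densities and the convergence of `tailProb` -/

namespace PlaneTree

open BinaryTree MeasureTheory

/-- With s = 1/(4x) the density is a multiple of e^(-s) s^(3/2). Bounding this gives boundedness,
and sparing one more power of s gives the linear bound near 0, hence continuity there. -/
lemma stableDensity_eq {x : ℝ} (hx : 0 < x) :
    stableDensity x = 4 / √Real.pi *
      (Real.exp (-(1 / (4 * x))) * ((1 / (4 * x)) ^ 1 * √(1 / (4 * x)))) := by
  rw [stableDensity, if_pos hx, rpow_three_halves hx.le, Real.sqrt_div (by norm_num),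
    Real.sqrt_mul (by norm_num), show (4 : ℝ) = 2 ^ 2 by norm_num, Real.sqrt_sq (by norm_num),
    neg_div, Real.sqrt_one]
  have := Real.sqrt_pos.2 hx
  field_simp

lemma stableDensity_nonneg (x : ℝ) : 0 ≤ stableDensity x := by
  rw [stableDensity]; split_ifs <;> positivity

lemma one_le_sqrt_pi : 1 ≤ √Real.pi := by
  rw [Real.one_le_sqrt]; linarith [Real.pi_gt_three]

lemma stableDensity_le (x : ℝ) : stableDensity x ≤ 12 := by
  rcases lt_or_ge 0 x with hx | hx
  · rw [stableDensity_eq hx]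
    have h := exp_neg_mul_pow_mul_sqrt_le (show 0 ≤ 1 / (4 * x) by positivity) 1
    have h4 : 4 / √Real.pi ≤ 4 := div_le_self (by norm_num) one_le_sqrt_pi
    calc _ ≤ 4 * ((1).factorial + (1 + 1).factorial : ℝ) := by gcongr
      _ = 12 := by norm_num [Nat.factorial]
  · rw [stableDensity, if_neg hx.not_gt]; norm_num

lemma stableDensity_le_abs (x : ℝ) : stableDensity x ≤ 128 * |x| := by
  rcases lt_or_ge 0 x with hx | hx
  · rw [stableDensity_eq hx, abs_of_pos hx]
    have h := exp_neg_mul_pow_mul_sqrt_le (show 0 ≤ 1 / (4 * x) by positivity) 2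
    have h4 : 4 / √Real.pi ≤ 4 := div_le_self (by norm_num) one_le_sqrt_pi
    calc _ = 4 / √Real.pi * (Real.exp (-(1 / (4 * x))) *
          ((1 / (4 * x)) ^ 2 * √(1 / (4 * x)))) * (4 * x) := by field_simp
      _ ≤ 4 * ((2).factorial + (2 + 1).factorial : ℝ) * (4 * x) := by gcongr
      _ = 128 * x := by norm_num [Nat.factorial]; ring
  · rw [stableDensity, if_neg hx.not_gt]; positivity

lemma stableDensity_of_nonpos {x : ℝ} (hx : x ≤ 0) : stableDensity x = 0 :=
  if_neg hx.not_gt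

lemma continuous_stableDensity : Continuous stableDensity := by
  rw [continuous_iff_continuousAt]
  intro x
  rcases lt_trichotomy x 0 with hx | rfl | hx
  · refine ContinuousAt.congr (f := fun _ => 0) continuousAt_const ?_
    filter_upwards [gt_mem_nhds hx] with y hy
    rw [stableDensity_of_nonpos hy.le]
  · rw [ContinuousAt, stableDensity_of_nonpos le_rfl]
    refine squeeze_zero (fun y => stableDensity_nonneg y) stableDensity_le_abs ?_
    have : ContinuousAt (fun y : ℝ => 128 * |y|) 0 := by fun_prop
    simpa [ContinuousAt] using this
  · refine ContinuousAt.congr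
      (f := fun x => Real.exp (-1 / (4 * x)) / (2 * √Real.pi * x ^ (3 / 2 : ℝ))) ?_ ?_
    · have h1 : ContinuousAt (fun x : ℝ => x ^ (3 / 2 : ℝ)) x :=
        Real.continuousAt_rpow_const _ _ (Or.inl hx.ne')
      have h2 : 4 * x ≠ 0 := by positivity
      have h3 : 2 * √Real.pi * x ^ (3 / 2 : ℝ) ≠ 0 := by positivity
      fun_prop (disch := assumption)
    · filter_upwards [lt_mem_nhds hx] with y hy
      rw [stableDensity, if_pos hy]

lemma jumpDensity_zero_eq (ε : ℝ) : jumpDensity ε 0 =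
    (Set.Ici ε).indicator fun x => 1 / (2 * √Real.pi * x ^ (3 / 2 : ℝ)) := by
  funext x
  rw [jumpDensity, Set.indicator_apply]
  rfl

lemma measurable_jumpDensity_zero (ε : ℝ) : Measurable (jumpDensity ε 0) := by
  rw [jumpDensity_zero_eq]
  refine Measurable.indicator ?_ measurableSet_Ici
  fun_prop

lemma integrable_jumpDensity_zero {ε : ℝ} (hε : 0 < ε) : Integrable (jumpDensity ε 0) := by
  rw [jumpDensity_zero_eq, integrable_indicator_iff measurableSet_Ici,
    integrableOn_Ici_iff_integrableOn_Ioi]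
  refine IntegrableOn.congr_fun ((integrableOn_Ioi_rpow_of_lt (a := -(3 / 2 : ℝ)) (by norm_num)
    hε).const_mul (1 / (2 * √Real.pi))) (fun x hx => ?_) measurableSet_Ioi
  have hx0 : 0 < x := hε.trans hx
  rw [Real.rpow_neg hx0.le]
  field_simp

lemma jumpDensity_zero_nonneg {ε : ℝ} (hε : 0 < ε) (x : ℝ) : 0 ≤ jumpDensity ε 0 x := by
  rw [jumpDensity]
  split_ifs with h
  · have : 0 < x := hε.trans_le h
    positivity
  · exact le_rfl

lemma jumpDensity_zero_of_lt {ε x : ℝ} (h : x < ε) : jumpDensity ε 0 x = 0 :=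
  if_neg h.not_ge

/-- The limiting density of `tailProb`. -/
noncomputable def tailDensity (ε w : ℝ) : ℕ → ℝ → ℝ
  | 0, z => stableDensity (z / w ^ 2) / w ^ 2
  | k + 1, z => ∫ u, jumpDensity ε 0 u * tailDensity ε w k (z - u)

lemma tailDensity_of_le {ε : ℝ} (w : ℝ) (k : ℕ) {z : ℝ} (hz : z ≤ k * ε) :
    tailDensity ε w k z = 0 := by
  induction k generalizing z with
  | zero =>
    rw [Nat.cast_zero, zero_mul] at hz
    rw [tailDensity, stableDensity_of_nonpos (div_nonpos_of_nonpos_of_nonneg hz (sq_nonneg w)),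
      zero_div]
  | succ k ih =>
    rw [tailDensity]
    refine integral_eq_zero_of_ae (Eventually.of_forall fun u => ?_)
    push_cast at hz
    rcases lt_or_ge u ε with h | h
    · simp [jumpDensity_zero_of_lt h]
    · simp [ih (show z - u ≤ k * ε by linarith)]

lemma tailDensity_of_nonpos {ε : ℝ} (hε : 0 < ε) (w : ℝ) (k : ℕ) {z : ℝ} (hz : z ≤ 0) :
    tailDensity ε w k z = 0 :=
  tailDensity_of_le w k (hz.trans (by positivity))

lemma tailDensity_nonneg {ε : ℝ} (hε : 0 < ε) (w : ℝ) (k : ℕ) (z : ℝ) :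
    0 ≤ tailDensity ε w k z := by
  induction k generalizing z with
  | zero => exact div_nonneg (stableDensity_nonneg _) (sq_nonneg _)
  | succ k ih => exact integral_nonneg fun u => mul_nonneg (jumpDensity_zero_nonneg hε u) (ih _)

lemma exists_tailDensity_le {ε : ℝ} (hε : 0 < ε) {c : ℝ} (hc : 0 < c) (k : ℕ) :
    ∃ C : ℝ, 0 ≤ C ∧ ∀ w, c ≤ w → ∀ z, tailDensity ε w k z ≤ C := by
  induction k with
  | zero =>
    refine ⟨12 / c ^ 2, by positivity, fun w hw z => ?_⟩
    rw [tailDensity]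
    have := stableDensity_le (z / w ^ 2)
    gcongr
  | succ k ih =>
    obtain ⟨C, hC0, hC⟩ := ih
    refine ⟨∫ u, jumpDensity ε 0 u * C, integral_nonneg fun u =>
      mul_nonneg (jumpDensity_zero_nonneg hε u) hC0, fun w hw z => ?_⟩
    rw [tailDensity]
    exact integral_mono_of_nonneg (Eventually.of_forall fun u =>
        mul_nonneg (jumpDensity_zero_nonneg hε u) (tailDensity_nonneg hε _ _ _))
      ((integrable_jumpDensity_zero hε).mul_const C)
      (Eventually.of_forall fun u =>
        mul_le_mul_of_nonneg_left (hC w hw _) (jumpDensity_zero_nonneg hε u))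

/-- Dominated convergence: near w the densities of order k share one bound, valid for all parameters
at least w/2, and the jump density is integrable. -/
theorem continuousAt_tailDensity {ε : ℝ} (hε : 0 < ε) (k : ℕ) {w : ℝ} (hw : 0 < w) (z : ℝ) :
    ContinuousAt (fun p : ℝ × ℝ => tailDensity ε p.1 k p.2) (w, z) := by
  induction k generalizing w z with
  | zero =>
    simp only [tailDensity]
    have hw2 : (fun p : ℝ × ℝ => p.1 ^ 2) (w, z) ≠ 0 := by simp [hw.ne']
    refine ContinuousAt.div (continuous_stableDensity.continuousAt.comp
      (ContinuousAt.div (by fun_prop) (by fun_prop) hw2)) (by fun_prop) hw2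
  | succ k ih =>
    obtain ⟨C, hC0, hC⟩ := exists_tailDensity_le hε (half_pos hw) k
    have hev : ∀ᶠ p : ℝ × ℝ in 𝓝 (w, z), w / 2 < p.1 :=
      continuous_fst.continuousAt.eventually (lt_mem_nhds (half_lt_self hw))
    simp only [tailDensity]
    refine tendsto_integral_filter_of_dominated_convergence (fun u => jumpDensity ε 0 u * C)
      ?_ ?_ ((integrable_jumpDensity_zero hε).mul_const C) ?_
    · filter_upwards [hev] with p hp
      refine ((measurable_jumpDensity_zero ε).aestronglyMeasurable).mul
        (Continuous.aestronglyMeasurable ?_)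
      rw [continuous_iff_continuousAt]
      intro u
      exact (ih ((half_pos hw).trans hp) (p.2 - u)).comp (f := fun u => (p.1, p.2 - u))
        (by fun_prop)
    · filter_upwards [hev] with p hp
      refine Eventually.of_forall fun u => ?_
      rw [Real.norm_of_nonneg (mul_nonneg (jumpDensity_zero_nonneg hε u)
        (tailDensity_nonneg hε _ _ _))]
      exact mul_le_mul_of_nonneg_left (hC _ hp.le _) (jumpDensity_zero_nonneg hε u)
    · refine Eventually.of_forall fun u => ?_
      exact ((ih hw (z - u)).comp (f := fun p : ℝ × ℝ => (p.1, p.2 - u)) (x := (w, z))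
        (by fun_prop)).const_mul _

lemma continuous_tailDensity {ε : ℝ} (hε : 0 < ε) (k : ℕ) {w : ℝ} (hw : 0 < w) :
    Continuous (tailDensity ε w k) := by
  rw [continuous_iff_continuousAt]
  intro z
  exact (continuousAt_tailDensity hε k hw z).comp (f := fun z => (w, z)) (by fun_prop)

/-- The substitution u = ε + v mirrors the index `a + 1 + i` of `tailProb_succ`, with i of order nv.
-/
lemma tailDensity_succ_eq {ε : ℝ} (hε : 0 < ε) (w : ℝ) (k : ℕ) {z : ℝ} (hz : z ≤ 1) :
    tailDensity ε w (k + 1) z =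
      ∫ v in (0 : ℝ)..1, jumpDensity ε 0 (ε + v) * tailDensity ε w k (z - (ε + v)) := by
  rw [intervalIntegral.integral_comp_add_left
    (fun u => jumpDensity ε 0 u * tailDensity ε w k (z - u)) ε, add_zero,
    intervalIntegral.integral_of_le (by linarith), tailDensity, ← integral_Icc_eq_integral_Ioc]
  symm
  refine setIntegral_eq_integral_of_forall_compl_eq_zero fun u hu => ?_
  rcases lt_or_ge u ε with h | h
  · rw [jumpDensity_zero_of_lt h, zero_mul]
  · rw [tailDensity_of_nonpos hε _ _ (z := z - u), mul_zero]
    by_contra hc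
    exact hu ⟨h, by linarith⟩

/-- Sums become integrals of step functions over [0, 1], so that dominated convergence handles
Riemann sums whose summand varies with n. -/
lemma sum_range_eq_integral (h : ℕ → ℝ) (n : ℕ) :
    ∑ i ∈ Finset.range n, h i = n * ∫ v in (0 : ℝ)..1, h ⌊(n : ℝ) * v⌋₊ := by
  have hE : ∀ i : ℕ, Set.EqOn (fun _ => h i) (fun x : ℝ => h ⌊x⌋₊)
      (Set.Ioo (i : ℝ) ((i + 1 : ℕ) : ℝ)) := fun i x hx => by
    have : ⌊x⌋₊ = i := by
      rw [Nat.floor_eq_iff ((Nat.cast_nonneg i).trans hx.1.le)]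
      exact ⟨hx.1.le, by simpa using hx.2⟩
    simp only [this]
  have hle : ∀ i : ℕ, (i : ℝ) ≤ ((i + 1 : ℕ) : ℝ) := fun i => by simp
  rw [intervalIntegral.mul_integral_comp_mul_left (f := fun x : ℝ => h ⌊x⌋₊), mul_zero, mul_one,
    show (0 : ℝ) = ((0 : ℕ) : ℝ) by simp,
    ← intervalIntegral.sum_integral_adjacent_intervals (a := fun i : ℕ => (i : ℝ))]
  · refine Finset.sum_congr rfl fun i _ => ?_
    rw [intervalIntegral.integral_of_le (hle i), integral_Ioc_eq_integral_Ioo,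
      ← setIntegral_congr_fun measurableSet_Ioo (hE i)]
    simp
  · intro i _
    rw [intervalIntegrable_iff_integrableOn_Ioo_of_le (hle i)]
    exact IntegrableOn.congr_fun (by simp) (hE i) measurableSet_Ioo

lemma tailProb_zero (a m : ℕ) (N : ℤ) : tailProb a 0 m N = intCoeff (stepSeries ^ m) N := by
  rw [tailProb, pow_zero, one_mul]

lemma tailProb_of_neg (a k m : ℕ) {N : ℤ} (h : N < 0) : tailProb a k m N = 0 :=
  intCoeff_of_neg _ h

lemma tailProb_nonneg (a k m : ℕ) (N : ℤ) : 0 ≤ tailProb a k m N := by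
  induction k generalizing N with
  | zero =>
    rw [tailProb_zero, intCoeff]
    split_ifs
    · exact coeff_stepSeries_pow_nonneg _ _
    · exact le_rfl
  | succ k ih =>
    rw [tailProb_succ a k m (Int.self_le_toNat N)]
    exact Finset.sum_nonneg fun i _ => mul_nonneg (stepProb_nonneg _) (ih _)

lemma tailProb_zero_le : ∃ C : ℝ, 0 ≤ C ∧ ∀ a m : ℕ, m ≠ 0 → ∀ N : ℤ,
    tailProb a 0 m N ≤ C * max (N : ℝ) 0 / m ^ 4 := by
  obtain ⟨C, hC0, hC⟩ := exists_coeff_stepSeries_pow_le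
  refine ⟨C, hC0, fun a m hm N => ?_⟩
  rcases lt_or_ge N 0 with hN | hN
  · rw [tailProb_of_neg _ _ _ hN]; positivity
  lift N to ℕ using hN
  rw [tailProb_zero, intCoeff_natCast]
  refine (hC m hm N).trans ?_
  gcongr
  exact le_max_left _ _

lemma mul_le_floor_add {ε : ℝ} (n i : ℕ) :
    ε * n ≤ ((⌊ε * n⌋₊ + 1 + i : ℕ) : ℝ) := by
  have := (Nat.lt_floor_add_one (ε * n)).le
  push_cast
  linarith [Nat.cast_nonneg (α := ℝ) i]

/-- Each large step costs a factor √n: at most n possible sizes, each of probability O(n^(-3/2)). -/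
theorem exists_tailProb_le {ε : ℝ} (hε : 0 < ε) {c : ℝ} (hc : 0 < c) (k : ℕ) :
    ∃ C : ℝ, 0 ≤ C ∧ ∀ n m : ℕ, n ≠ 0 → c * √n ≤ m → ∀ N : ℤ, N ≤ n →
      n * √n ^ k * tailProb ⌊ε * n⌋₊ k m N ≤ C := by
  induction k with
  | zero =>
    obtain ⟨C, hC0, hC⟩ := tailProb_zero_le
    refine ⟨C / c ^ 4, by positivity, fun n m hn hm N hN => ?_⟩
    have hn' : (0 : ℝ) < n := by positivity
    have hm0 : (0 : ℝ) < m := lt_of_lt_of_le (by positivity) hm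
    have hNn : max (N : ℝ) 0 ≤ n := max_le (by exact_mod_cast hN) hn'.le
    have h4 : c ^ 4 * n ^ 2 ≤ (m : ℝ) ^ 4 := by
      calc c ^ 4 * (n : ℝ) ^ 2 = (c * √n) ^ 4 := by
            rw [mul_pow, show √(n : ℝ) ^ 4 = (√n ^ 2) ^ 2 by ring, Real.sq_sqrt hn'.le]
        _ ≤ _ := by gcongr
    rw [pow_zero, mul_one]
    calc (n : ℝ) * tailProb ⌊ε * n⌋₊ 0 m N ≤ n * (C * n / (c ^ 4 * n ^ 2)) := by
          have h := hC ⌊ε * n⌋₊ m (by rintro rfl; simp at hm0) N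
          gcongr
          refine h.trans ?_
          gcongr
      _ = C / c ^ 4 := by field_simp
  | succ k ih =>
    obtain ⟨C, hC0, hC⟩ := ih
    obtain ⟨D, hD0, hD⟩ := exists_stepProb_scaled_le
    refine ⟨D / (ε * √ε) * C, by positivity, fun n m hn hm N hN => ?_⟩
    have hn' : (0 : ℝ) < n := by positivity
    rw [tailProb_succ _ _ _ hN, Finset.mul_sum]
    calc _ ≤ ∑ i ∈ Finset.range n, D / (ε * √ε) * C / n := by
          refine Finset.sum_le_sum fun i _ => ?_
          have h₁ := hD ε hε n (⌊ε * n⌋₊ + 1 + i) (mul_le_floor_add n i)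
          have h₂ := hC n m hn hm (N - (⌊ε * n⌋₊ + 1 + i : ℕ)) (by omega)
          rw [le_div_iff₀ hn']
          calc _ = (n * √n * stepProb (⌊ε * n⌋₊ + 1 + i)) *
                (n * √n ^ k * tailProb ⌊ε * n⌋₊ k m (N - (⌊ε * n⌋₊ + 1 + i : ℕ))) := by ring
            _ ≤ _ := mul_le_mul h₁ h₂ (mul_nonneg (by positivity) (tailProb_nonneg _ _ _ _))
                (by positivity)
      _ = D / (ε * √ε) * C := by
          rw [Finset.sum_const, Finset.card_range, nsmul_eq_mul]; field_simp

lemma tendsto_floor_div {ι : Type*} {l : Filter ι} {n : ι → ℕ} (hn : Tendsto n l atTop)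
    {x : ℝ} (hx : 0 ≤ x) : Tendsto (fun i => (⌊x * n i⌋₊ : ℝ) / n i) l (𝓝 x) :=
  (tendsto_nat_floor_mul_div_atTop hx).comp (tendsto_natCast_atTop_atTop.comp hn)

/-- Induction on k, by dominated convergence in the recursion on one large step. The statement is
for all N and z because the recursion shifts both. -/
theorem tendsto_tailProb {ι : Type*} {l : Filter ι} [l.IsCountablyGenerated] [l.NeBot]
    {ε : ℝ} (hε : 0 < ε) {n m : ι → ℕ} (hn : Tendsto n l atTop) {w : ℝ} (hw : 0 < w)
    (hm : Tendsto (fun i => (m i : ℝ) / √(n i)) l (𝓝 w)) (k : ℕ) (N : ι → ℤ) (z : ℝ)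
    (hN : ∀ i, N i ≤ n i) (hz : Tendsto (fun i => (N i : ℝ) / n i) l (𝓝 z)) :
    Tendsto (fun i => n i * √(n i) ^ k * tailProb ⌊ε * n i⌋₊ k (m i) (N i)) l
      (𝓝 (tailDensity ε w k z)) := by
  have hn' : Tendsto (fun i => (n i : ℝ)) l atTop := tendsto_natCast_atTop_atTop.comp hn
  have hn0 : ∀ᶠ i in l, (0 : ℝ) < n i := hn'.eventually_gt_atTop 0
  have hm1 : ∀ᶠ i in l, w / 2 * √(n i) ≤ m i := by
    filter_upwards [hm.eventually (lt_mem_nhds (half_lt_self hw)), hn0] with i hi hni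
    rw [lt_div_iff₀ (by positivity)] at hi
    exact hi.le
  have hm0 : ∀ᶠ i in l, (0 : ℝ) < m i := by
    filter_upwards [hm1, hn0] with i hi hni
    exact lt_of_lt_of_le (by positivity) hi
  induction k generalizing N z with
  | zero =>
    -- The local limit theorem needs z > 0; for z ≤ 0 the bound linear in max(N, 0) gives the limit
    -- 0.
    rcases le_or_gt z 0 with hz0 | hz0
    · rw [tailDensity_of_nonpos hε _ _ hz0]
      obtain ⟨C, hC0, hC⟩ := tailProb_zero_le
      have h₁ : Tendsto (fun i => C * max ((N i : ℝ) / n i) 0 / ((m i : ℝ) / √(n i)) ^ 4) l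
          (𝓝 (C * max z 0 / w ^ 4)) :=
        ((hz.max tendsto_const_nhds).const_mul C).div (hm.pow 4) (by positivity)
      rw [max_eq_right hz0, mul_zero, zero_div] at h₁
      refine squeeze_zero' (Eventually.of_forall fun i =>
        mul_nonneg (by positivity) (tailProb_nonneg _ _ _ _)) ?_ h₁
      filter_upwards [hn0, hm0] with i hi hmi
      have h := hC ⌊ε * n i⌋₊ (m i) (by rintro h; simp [h] at hmi) (N i)
      have e : max ((N i : ℝ) / n i) 0 = max (N i : ℝ) 0 / n i := by
        rw [← max_div_div_right hi.le, zero_div]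
      have e4 : √(n i : ℝ) ^ 4 = n i ^ 2 := by
        rw [show √(n i : ℝ) ^ 4 = (√(n i) ^ 2) ^ 2 by ring, Real.sq_sqrt hi.le]
      rw [pow_zero, mul_one, e, div_pow, e4]
      calc (n i : ℝ) * tailProb ⌊ε * n i⌋₊ 0 (m i) (N i)
          ≤ n i * (C * max (N i : ℝ) 0 / m i ^ 4) := by gcongr
        _ = _ := by field_simp
    · have hmn : Tendsto (fun i => (m i : ℝ) / n i) l (𝓝 0) := by
        have h := hm.mul (tendsto_inv_atTop_zero.comp (Real.tendsto_sqrt_atTop.comp hn'))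
        rw [mul_zero] at h
        refine h.congr' ?_
        filter_upwards [hn0] with i hi
        simp only [Function.comp]
        rw [← div_eq_mul_inv, div_div, Real.mul_self_sqrt hi.le]
      have hd := hz.sub hmn
      rw [sub_zero] at hd
      have hpos : ∀ᶠ i in l, (m i : ℤ) ≤ N i := by
        filter_upwards [hn0, hd.eventually (lt_mem_nhds hz0)] with i hi hdi
        rw [← sub_div, lt_div_iff₀ hi, zero_mul, sub_pos] at hdi
        exact_mod_cast hdi.le
      have hr : Tendsto (fun i => ((N i - m i).toNat : ℝ) / n i) l (𝓝 z) := by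
        refine hd.congr' ?_
        filter_upwards [hpos] with i hi
        have h : (((N i - m i).toNat : ℤ) : ℝ) = N i - m i := by
          rw [Int.toNat_of_nonneg (by omega)]; push_cast; rfl
        rw [← sub_div, ← h, Int.cast_natCast]
      refine (tendsto_coeff_stepSeries_pow hn hw hz0 hm hr).congr' ?_
      filter_upwards [hpos] with i hi
      rw [pow_zero, mul_one, tailProb_zero, ← intCoeff_natCast]
      congr 2
      push_cast
      omega
  | succ k ih =>
    obtain ⟨C, hC0, hC⟩ := exists_tailProb_le hε (half_pos hw) k
    obtain ⟨D, hD0, hD⟩ := exists_stepProb_scaled_le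
    have hz1 : z ≤ 1 := by
      refine le_of_tendsto hz ?_
      filter_upwards [hn0] with i hi
      rw [div_le_one hi]
      exact_mod_cast hN i
    rw [tailDensity_succ_eq hε w k hz1]
    have hint : ∀ᶠ i in l, (∫ v in (0 : ℝ)..1,
        (n i * √(n i) * stepProb (⌊ε * n i⌋₊ + 1 + ⌊(n i : ℝ) * v⌋₊)) *
        (n i * √(n i) ^ k * tailProb ⌊ε * n i⌋₊ k (m i)
          (N i - (⌊ε * n i⌋₊ + 1 + ⌊(n i : ℝ) * v⌋₊ : ℕ)))) =
        n i * √(n i) ^ (k + 1) * tailProb ⌊ε * n i⌋₊ (k + 1) (m i) (N i) := by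
      refine Eventually.of_forall fun i => ?_
      rw [tailProb_succ _ _ _ (hN i), Finset.mul_sum, sum_range_eq_integral,
        ← intervalIntegral.integral_const_mul]
      congr 1
      funext v
      ring
    refine Tendsto.congr' hint ?_
    refine intervalIntegral.tendsto_integral_filter_of_dominated_convergence
      (fun _ => D / (ε * √ε) * C) ?_ ?_ intervalIntegrable_const ?_
    · refine Eventually.of_forall fun i => Measurable.aestronglyMeasurable ?_
      have hf : Measurable fun v : ℝ => ⌊(n i : ℝ) * v⌋₊ :=
        Nat.measurable_floor.comp (measurable_const_mul _)
      exact (measurable_from_nat (f := fun j => (n i * √(n i) * stepProb (⌊ε * n i⌋₊ + 1 + j)) *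
        (n i * √(n i) ^ k * tailProb ⌊ε * n i⌋₊ k (m i)
          (N i - (⌊ε * n i⌋₊ + 1 + j : ℕ))))).comp hf
    · filter_upwards [hn0, hm1] with i hi hmi
      refine Eventually.of_forall fun v _ => ?_
      have hi' : n i ≠ 0 := by rintro h; simp [h] at hi
      have h₁ := hD ε hε (n i) (⌊ε * n i⌋₊ + 1 + ⌊(n i : ℝ) * v⌋₊) (mul_le_floor_add _ _)
      have h₂ := hC (n i) (m i) hi' hmi (N i - (⌊ε * n i⌋₊ + 1 + ⌊(n i : ℝ) * v⌋₊ : ℕ))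
        (by have := hN i; omega)
      have h₃ := stepProb_nonneg (⌊ε * n i⌋₊ + 1 + ⌊(n i : ℝ) * v⌋₊)
      have h₄ := tailProb_nonneg ⌊ε * n i⌋₊ k (m i)
        (N i - (⌊ε * n i⌋₊ + 1 + ⌊(n i : ℝ) * v⌋₊ : ℕ))
      rw [Real.norm_of_nonneg (by positivity)]
      exact mul_le_mul h₁ h₂ (by positivity) (by positivity)
    · refine Eventually.of_forall fun v hv => ?_
      rw [Set.uIoc_of_le zero_le_one] at hv
      have hv0 : 0 ≤ v := hv.1.le
      have hj : Tendsto (fun i => ((⌊ε * n i⌋₊ + 1 + ⌊(n i : ℝ) * v⌋₊ : ℕ) : ℝ) / n i) l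
          (𝓝 (ε + v)) := by
        have h₁ := ((tendsto_floor_div hn hε.le).add
          (tendsto_inv_atTop_zero.comp hn')).add (tendsto_floor_div hn hv0)
        rw [add_zero] at h₁
        refine h₁.congr fun i => ?_
        simp only [Function.comp]
        rw [mul_comm v]
        push_cast
        ring
      have hs := tendsto_stepProb_scaled hn (by positivity) hj
      have hρ : jumpDensity ε 0 (ε + v) = 1 / (2 * √Real.pi * (ε + v) ^ (3 / 2 : ℝ)) := by
        rw [jumpDensity, if_pos (by linarith)]
      rw [hρ]
      refine hs.mul (ih _ _ (fun i => by have := hN i; omega) ?_)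
      refine (hz.sub hj).congr fun i => ?_
      rw [← sub_div]
      push_cast
      rfl

end PlaneTree

/-! ### Forks at the leaves of the skeleton -/

namespace PlaneTree

open BinaryTree MeasureTheory

lemma forkDensity_eq_integral {ε η : ℝ} (hε' : ε < 1) (hη : ε < η) (hη' : η ≤ 2 * ε) :
    forkDensity ε η = ∫ v in (0 : ℝ)..1, (Set.Ioo (η - ε) ε).indicator (fun v =>
      1 / (2 * √Real.pi * v ^ (3 / 2 : ℝ)) * (1 / (2 * √Real.pi * (η - v) ^ (3 / 2 : ℝ)))) v := by
  rw [intervalIntegral.integral_of_le zero_le_one, setIntegral_indicator measurableSet_Ioo,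
    Set.inter_eq_right.2 (show Set.Ioo (η - ε) ε ⊆ Set.Ioc 0 1 from
      fun v hv => ⟨by linarith [hv.1], by linarith [hv.2]⟩), forkDensity,
    intervalIntegral.integral_of_le (by linarith), integral_Ioc_eq_integral_Ioo,
    ← integral_const_mul]
  refine setIntegral_congr_fun measurableSet_Ioo fun v hv => ?_
  have h₁ : 0 < v := by linarith [hv.1]
  have h₂ : 0 < η - v := by linarith [hv.2]
  rw [Real.mul_rpow h₁.le h₂.le]
  have h₃ : 4 * Real.pi = (2 * √Real.pi) * (2 * √Real.pi) := by
    linear_combination (-4) * Real.mul_self_sqrt Real.pi_pos.le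
  rw [h₃]
  field_simp

/-- The coefficient is a Riemann sum over the size of the first of two small trees; the factor n² is
n^(3/2) for each tree, divided by the n of the sum. -/
theorem tendsto_coeff_sub_sq {ι : Type*} {l : Filter ι} [l.IsCountablyGenerated]
    {ε η : ℝ} (hε : 0 < ε) (hε' : ε < 1) (hη : ε < η) (hη' : η ≤ 2 * ε) {n y : ι → ℕ}
    (hn : Tendsto n l atTop) (hy : Tendsto (fun i => (y i : ℝ) / n i) l (𝓝 η)) :
    Tendsto (fun i => (n i : ℝ) ^ 2 *
      PowerSeries.coeff (y i) ((stepSeries - tailSeries ⌊ε * n i⌋₊) ^ 2)) l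
      (𝓝 (forkDensity ε η)) := by
  have hn' : Tendsto (fun i => (n i : ℝ)) l atTop := tendsto_natCast_atTop_atTop.comp hn
  have hn0 : ∀ᶠ i in l, (0 : ℝ) < n i := hn'.eventually_gt_atTop 0
  obtain ⟨D, hD0, hD⟩ := exists_stepProb_scaled_le
  have hint : ∀ᶠ i in l, (∫ v in (0 : ℝ)..1,
      if ⌊(n i : ℝ) * v⌋₊ ≤ ⌊ε * n i⌋₊ ∧ y i ≤ ⌊(n i : ℝ) * v⌋₊ + ⌊ε * n i⌋₊ then
        (n i * √(n i) * stepProb ⌊(n i : ℝ) * v⌋₊) *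
        (n i * √(n i) * stepProb (y i - ⌊(n i : ℝ) * v⌋₊)) else 0) =
      (n i : ℝ) ^ 2 *
        PowerSeries.coeff (y i) ((stepSeries - tailSeries ⌊ε * n i⌋₊) ^ 2) := by
    filter_upwards [hn0] with i hi
    have ha : ⌊ε * n i⌋₊ < n i := by
      rw [Nat.floor_lt (by positivity)]; nlinarith
    rw [coeff_sub_sq (y i) ha, sum_range_eq_integral, ← intervalIntegral.integral_const_mul,
      ← intervalIntegral.integral_const_mul]
    congr 1
    funext v
    have hs := Real.mul_self_sqrt hi.le
    split_ifs
    · linear_combination (n i : ℝ) ^ 2 * stepProb ⌊(n i : ℝ) * v⌋₊ *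
        stepProb (y i - ⌊(n i : ℝ) * v⌋₊) * hs
    · ring
  rw [forkDensity_eq_integral hε' hη hη']
  refine Tendsto.congr' hint ?_
  -- Eventually y ≥ (ε + δ)n, so two sizes at most εn with sum y are both at least δn, away from the
  -- singularity of the step density at 0.
  set δ := (η - ε) / 2 with hδ
  have hδ0 : 0 < δ := by rw [hδ]; linarith
  have hyδ : ∀ᶠ i in l, δ * n i + ε * n i ≤ y i := by
    filter_upwards [hn0, hy.eventually (lt_mem_nhds (show ε + δ < η by linarith))] with i hi h
    rw [lt_div_iff₀ hi] at h
    linarith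
  refine intervalIntegral.tendsto_integral_filter_of_dominated_convergence
    (fun _ => D / (δ * √δ) * (D / (δ * √δ))) ?_ ?_ intervalIntegrable_const ?_
  · refine Eventually.of_forall fun i => Measurable.aestronglyMeasurable ?_
    have hf : Measurable fun v : ℝ => ⌊(n i : ℝ) * v⌋₊ :=
      Nat.measurable_floor.comp (measurable_const_mul _)
    exact (measurable_from_nat (f := fun j =>
      if j ≤ ⌊ε * n i⌋₊ ∧ y i ≤ j + ⌊ε * n i⌋₊ then
        (n i * √(n i) * stepProb j) * (n i * √(n i) * stepProb (y i - j)) else 0)).comp hf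
  · filter_upwards [hn0, hyδ] with i hi hyi
    refine Eventually.of_forall fun v _ => ?_
    set j := ⌊(n i : ℝ) * v⌋₊
    have ha := Nat.floor_le (show 0 ≤ ε * n i by positivity)
    split_ifs with h
    · have h₁ : (j : ℝ) ≤ ⌊ε * n i⌋₊ := by exact_mod_cast h.1
      have h₂ : (y i : ℝ) ≤ j + ⌊ε * n i⌋₊ := by exact_mod_cast h.2
      have hjy : (j : ℝ) ≤ y i := by nlinarith
      have b₁ := hD δ hδ0 (n i) j (by linarith)
      have b₂ := hD δ hδ0 (n i) (y i - j) (by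
        rw [Nat.cast_sub (by exact_mod_cast hjy)]; linarith)
      have h₃ := stepProb_nonneg j
      have h₄ := stepProb_nonneg (y i - j)
      rw [Real.norm_of_nonneg (by positivity)]
      exact mul_le_mul b₁ b₂ (by positivity) (by positivity)
    · rw [norm_zero]; positivity
  -- The two endpoints, where the limits do not decide the size constraints, form a null set.
  · have hfin := (Set.toFinite {ε, η - ε}).countable.ae_notMem (volume : Measure ℝ)
    filter_upwards [hfin] with v hv hv01
    simp only [Set.mem_insert_iff, Set.mem_singleton_iff, not_or] at hv
    rw [Set.uIoc_of_le zero_le_one] at hv01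
    have hj : Tendsto (fun i => (⌊(n i : ℝ) * v⌋₊ : ℝ) / n i) l (𝓝 v) :=
      (tendsto_floor_div hn hv01.1.le).congr fun i => by rw [mul_comm v]
    have ha := tendsto_floor_div hn hε.le
    by_cases hin : v ∈ Set.Ioo (η - ε) ε
    · rw [Set.indicator_of_mem hin]
      have e₁ : ∀ᶠ i in l, ⌊(n i : ℝ) * v⌋₊ ≤ ⌊ε * n i⌋₊ := by
        filter_upwards with i
        rw [mul_comm]
        exact Nat.floor_mono (mul_le_mul_of_nonneg_right hin.2.le (Nat.cast_nonneg _))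
      have e₂ : ∀ᶠ i in l, y i ≤ ⌊(n i : ℝ) * v⌋₊ + ⌊ε * n i⌋₊ := by
        filter_upwards [hn0, hy.eventually_lt (hj.add ha) (by linarith [hin.1])] with i hi h
        rw [← add_div, div_lt_div_iff_of_pos_right hi] at h
        exact_mod_cast h.le
      have e₃ : ∀ᶠ i in l, ⌊(n i : ℝ) * v⌋₊ ≤ y i := by
        filter_upwards [hn0, hj.eventually_lt hy (by linarith [hin.2])] with i hi h
        rw [div_lt_div_iff_of_pos_right hi] at h
        exact_mod_cast h.le
      have hd : Tendsto (fun i => ((y i - ⌊(n i : ℝ) * v⌋₊ : ℕ) : ℝ) / n i) l (𝓝 (η - v)) := by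
        refine (hy.sub hj).congr' ?_
        filter_upwards [e₃] with i h
        rw [Nat.cast_sub h, sub_div]
      refine ((tendsto_stepProb_scaled hn hv01.1 hj).mul
        (tendsto_stepProb_scaled hn (by linarith [hin.2]) hd)).congr' ?_
      filter_upwards [e₁, e₂] with i h₁ h₂
      rw [if_pos ⟨h₁, h₂⟩]
    · rw [Set.indicator_of_notMem hin]
      refine tendsto_const_nhds.congr' ?_
      rcases lt_or_gt_of_ne hv.1 with h | h
      · have h' : v < η - ε := lt_of_le_of_ne (not_lt.1 fun h' => hin ⟨h', h⟩) hv.2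
        filter_upwards [hn0, (hj.add ha).eventually_lt hy (by linarith)] with i hi h₁
        rw [← add_div, div_lt_div_iff_of_pos_right hi] at h₁
        have h₂ : ⌊(n i : ℝ) * v⌋₊ + ⌊ε * n i⌋₊ < y i := by exact_mod_cast h₁
        rw [if_neg (fun h => by omega)]
      · filter_upwards [hn0, ha.eventually_lt hj h] with i hi h₁
        rw [div_lt_div_iff_of_pos_right hi] at h₁
        have h₂ : ⌊ε * n i⌋₊ < ⌊(n i : ℝ) * v⌋₊ := by exact_mod_cast h₁
        rw [if_neg (fun h => by omega)]

/-- Raising both factors to at least δ makes the integrand jointly continuous without changing it on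
the interval of integration for y > ε + δ; integrals with moving endpoints are then continuous. -/
theorem continuousWithinAt_forkDensity {ε η : ℝ} (hη : ε < η) (hη' : η ≤ 2 * ε) :
    ContinuousWithinAt (forkDensity ε) (Set.Iic (2 * ε)) η := by
  set δ := (η - ε) / 2 with hδ
  have hδ0 : 0 < δ := by rw [hδ]; linarith
  set f : ℝ → ℝ → ℝ := fun y u => 1 / (max u δ * max (y - u) δ) ^ (3 / 2 : ℝ) with hf
  have hfc : Continuous (Function.uncurry f) := by
    have hpos : ∀ p : ℝ × ℝ, 0 < max p.2 δ * max (p.1 - p.2) δ := fun p =>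
      mul_pos (lt_max_of_lt_right hδ0) (lt_max_of_lt_right hδ0)
    refine continuous_const.div (Continuous.rpow_const (by fun_prop) fun p =>
      Or.inl (hpos p).ne') fun p => ?_
    exact (Real.rpow_pos_of_pos (hpos p) _).ne'
  have hF : Continuous fun y => 1 / (4 * Real.pi) *
      ((∫ u in (0 : ℝ)..ε, f y u) - ∫ u in (0 : ℝ)..(y - ε), f y u) := by
    refine continuous_const.mul (Continuous.sub ?_ ?_)
    · exact intervalIntegral.continuous_parametric_intervalIntegral_of_continuous hfc
        continuous_const
    · exact intervalIntegral.continuous_parametric_intervalIntegral_of_continuous hfc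
        (by fun_prop)
  have hint : ∀ y a b, IntervalIntegrable (f y) volume a b := fun y a b =>
    (hfc.comp (by fun_prop : Continuous fun u : ℝ => (y, u))).intervalIntegrable a b
  have key : ∀ y, ε + δ < y → y ≤ 2 * ε → forkDensity ε y = 1 / (4 * Real.pi) *
      ((∫ u in (0 : ℝ)..ε, f y u) - ∫ u in (0 : ℝ)..(y - ε), f y u) := fun y hy hy' => by
    rw [intervalIntegral.integral_interval_sub_left (hint _ _ _) (hint _ _ _), forkDensity]
    congr 1
    refine intervalIntegral.integral_congr fun u hu => ?_
    rw [Set.uIcc_of_le (by linarith)] at hu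
    simp only [hf]
    rw [max_eq_left (by linarith [hu.1]), max_eq_left (by linarith [hu.2])]
  refine hF.continuousAt.continuousWithinAt.congr_of_eventuallyEq ?_
    (key η (by linarith) hη')
  filter_upwards [self_mem_nhdsWithin,
    mem_nhdsWithin_of_mem_nhds (lt_mem_nhds (show ε + δ < η by linarith))] with y hy hy'
  exact key y hy' hy

end PlaneTree

/-! ### Identification of the limit with ψ -/

namespace PlaneTree

open BinaryTree MeasureTheory

lemma jumpDensity_zero_le {ε : ℝ} (hε : 0 < ε) (x : ℝ) :
    jumpDensity ε 0 x ≤ 1 / (2 * √Real.pi * ε ^ (3 / 2 : ℝ)) := by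
  rw [jumpDensity]
  split_ifs with h
  · gcongr
  · positivity

/-- The indicators in a_1 encode the domain of integration, and (4π)^(1/2) = 2√π supplies one
normalising constant per jump. -/
lemma jumpDensity_eq_integral {ε : ℝ} (hε : 0 < ε) (k : ℕ) (x : ℝ) :
    jumpDensity ε k x =
      ∫ u : Fin k → ℝ, (∏ i, jumpDensity ε 0 (u i)) * jumpDensity ε 0 (x - ∑ i, u i) := by
  cases k with
  | zero =>
    rw [Measure.volume_pi_eq_dirac, integral_dirac]
    simp
  | succ k =>
    rw [jumpDensity]
    set S := {u : Fin (k + 1) → ℝ | (∀ i, ε ≤ u i) ∧ ∑ i, u i ≤ x - ε}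
    have hS : MeasurableSet S := by
      refine MeasurableSet.inter (s₁ := {u : Fin (k + 1) → ℝ | ∀ i, ε ≤ u i})
        (s₂ := {u | ∑ i, u i ≤ x - ε}) ?_ (measurableSet_le (by fun_prop) measurable_const)
      rw [Set.ofPred_forall]
      exact MeasurableSet.iInter fun i => measurableSet_le measurable_const (measurable_pi_apply i)
    rw [← integral_const_mul, ← integral_indicator hS]
    congr 1
    funext u
    by_cases hu : (∀ i, ε ≤ u i) ∧ ∑ i, u i ≤ x - ε
    · rw [Set.indicator_of_mem (show u ∈ S from hu)]
      have hpos : ∀ i, 0 < u i := fun i => hε.trans_le (hu.1 i)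
      have hx : 0 < x - ∑ i, u i := by linarith [hu.2]
      have h₁ : ∀ i, jumpDensity ε 0 (u i) = 1 / (2 * √Real.pi * u i ^ (3 / 2 : ℝ)) :=
        fun i => by rw [jumpDensity, if_pos (hu.1 i)]
      have h₂ : (4 * Real.pi) ^ (((k : ℝ) + 2) / 2) = (2 * √Real.pi) ^ (k + 2) := by
        rw [show (2 * √Real.pi) = √(4 * Real.pi) by
          rw [Real.sqrt_mul (by norm_num), show (4 : ℝ) = 2 ^ 2 by norm_num,
            Real.sqrt_sq (by norm_num)], Real.sqrt_eq_rpow, ← Real.rpow_natCast,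
          ← Real.rpow_mul (by positivity)]
        congr 1
        push_cast
        ring
      simp_rw [h₁]
      rw [jumpDensity, if_pos (by linarith [hu.2]), h₂,
        Real.mul_rpow (Finset.prod_nonneg fun i _ => (hpos i).le) hx.le,
        ← Real.finsetProd_rpow _ _ fun i _ => (hpos i).le]
      simp only [one_div, mul_inv, Finset.prod_mul_distrib, Finset.prod_inv_distrib,
        Finset.prod_const, Finset.card_univ, Fintype.card_fin]
      ring
    · rw [Set.indicator_of_notMem (show u ∉ S from hu)]
      rw [not_and_or, not_forall] at hu
      rcases hu with ⟨i, hi⟩ | hu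
      · rw [Finset.prod_eq_zero (Finset.mem_univ i) (jumpDensity_zero_of_lt (not_le.1 hi)),
          zero_mul]
      · rw [jumpDensity_zero_of_lt (x := x - _) (by linarith [not_le.1 hu]), mul_zero]

/-- Fubini, separating the first coordinate; integrability holds because the last jump factor is
bounded. -/
theorem jumpDensity_succ {ε : ℝ} (hε : 0 < ε) (k : ℕ) (x : ℝ) :
    jumpDensity ε (k + 1) x = ∫ u, jumpDensity ε 0 u * jumpDensity ε k (x - u) := by
  rw [jumpDensity_eq_integral hε,
    ← ((volume_preserving_piFinSuccAbove (fun _ : Fin (k + 1) => ℝ) 0).symm _).integral_comp'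
      (fun u : Fin (k + 1) → ℝ => (∏ i, jumpDensity ε 0 (u i)) *
        jumpDensity ε 0 (x - ∑ i, u i))]
  have e : ∀ p : ℝ × (Fin k → ℝ),
      (∏ i, jumpDensity ε 0 ((MeasurableEquiv.piFinSuccAbove (fun _ : Fin (k + 1) => ℝ) 0).symm
        p i)) * jumpDensity ε 0 (x - ∑ i, (MeasurableEquiv.piFinSuccAbove
          (fun _ : Fin (k + 1) => ℝ) 0).symm p i) =
      (jumpDensity ε 0 p.1 * ∏ i, jumpDensity ε 0 (p.2 i)) *
        jumpDensity ε 0 (x - p.1 - ∑ i, p.2 i) := fun p => by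
    simp [MeasurableEquiv.piFinSuccAbove, Fin.prod_univ_succ, Fin.sum_univ_succ, sub_sub]
  simp_rw [e]
  have hρ := integrable_jumpDensity_zero hε
  have hint : Integrable (fun p : ℝ × (Fin k → ℝ) =>
      (jumpDensity ε 0 p.1 * ∏ i, jumpDensity ε 0 (p.2 i)) *
        jumpDensity ε 0 (x - p.1 - ∑ i, p.2 i)) (volume.prod volume) := by
    refine (Integrable.mul_prod hρ (Integrable.fintype_prod fun _ => hρ)).mul_bdd
      (c := 1 / (2 * √Real.pi * ε ^ (3 / 2 : ℝ))) ?_ ?_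
    · exact ((measurable_jumpDensity_zero ε).comp (by fun_prop)).aestronglyMeasurable
    · refine Eventually.of_forall fun p => ?_
      rw [Real.norm_of_nonneg (jumpDensity_zero_nonneg hε _)]
      exact jumpDensity_zero_le hε _
  rw [Measure.volume_eq_prod, integral_prod _ hint]
  congr 1
  funext u
  rw [jumpDensity_eq_integral hε k, ← integral_const_mul]
  simp_rw [mul_assoc]

lemma integrable_jumpDensity {ε : ℝ} (hε : 0 < ε) (k : ℕ) : Integrable (jumpDensity ε k) := by
  induction k with
  | zero => exact integrable_jumpDensity_zero hε
  | succ k ih =>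
    have h := (integrable_jumpDensity_zero hε).integrable_convolution
      (ContinuousLinearMap.mul ℝ ℝ) ih
    refine h.congr (Eventually.of_forall fun x => ?_)
    rw [jumpDensity_succ hε]
    rfl

lemma jumpDensity_of_lt {ε : ℝ} (hε : 0 < ε) (k : ℕ) {x : ℝ} (hx : x < (k + 1) * ε) :
    jumpDensity ε k x = 0 := by
  induction k generalizing x with
  | zero => exact jumpDensity_zero_of_lt (by simpa using hx)
  | succ k ih =>
    rw [jumpDensity_succ hε]
    refine integral_eq_zero_of_ae (Eventually.of_forall fun u => ?_)
    push_cast at hx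
    rcases lt_or_ge u ε with h | h
    · simp [jumpDensity_zero_of_lt h]
    · simp [ih (show x - u < (k + 1) * ε by linarith)]

/-- Associativity of convolution: the jumps may be added to one another before being convolved with
g. -/
theorem tailDensity_succ_eq_integral_jumpDensity {ε : ℝ} (hε : 0 < ε) {w : ℝ} (hw : 0 < w)
    (k : ℕ) (z : ℝ) :
    tailDensity ε w (k + 1) z = ∫ u, tailDensity ε w 0 (z - u) * jumpDensity ε k u := by
  induction k generalizing z with
  | zero =>
    rw [tailDensity]
    simp_rw [mul_comm]
  | succ k ih =>
    obtain ⟨C, hC0, hC⟩ := exists_tailDensity_le hε hw 0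
    have h₁ : ∀ u, jumpDensity ε 0 u * tailDensity ε w (k + 1) (z - u) =
        ∫ v, tailDensity ε w 0 (z - v) * (jumpDensity ε 0 u * jumpDensity ε k (v - u)) := by
      intro u
      rw [ih, ← integral_sub_right_eq_self _ u, ← integral_const_mul]
      congr 1
      funext v
      rw [show z - u - (v - u) = z - v by ring]
      ring
    rw [tailDensity]
    simp_rw [h₁]
    rw [integral_integral_swap]
    · congr 1
      funext v
      rw [jumpDensity_succ hε, integral_const_mul]
    · have h₂ := (integrable_jumpDensity_zero hε).convolution_integrand
        (ContinuousLinearMap.mul ℝ ℝ) (integrable_jumpDensity hε k)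
      refine Integrable.bdd_mul (c := C) h₂.swap ?_ ?_
      · exact ((continuous_tailDensity hε 0 hw).comp (by fun_prop)).aestronglyMeasurable
      · refine Eventually.of_forall fun p => ?_
        rw [Real.norm_of_nonneg (tailDensity_nonneg hε _ _ _)]
        exact hC w le_rfl _

theorem convolvedDensity_eq {ε : ℝ} (hε : 0 < ε) {w : ℝ} (hw : 0 < w) (k : ℕ) (z : ℝ) :
    convolvedDensity ε w z k = w ^ 2 * tailDensity ε w k z := by
  have hw2 : w ^ 2 ≠ 0 := by positivity
  cases k with
  | zero => rw [convolvedDensity, tailDensity]; field_simp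
  | succ k =>
    rw [tailDensity_succ_eq_integral_jumpDensity hε hw, convolvedDensity, ← integral_const_mul]
    have h₁ : ∀ u, stableDensity ((z - u) / w ^ 2) * jumpDensity ε k u =
        w ^ 2 * (tailDensity ε w 0 (z - u) * jumpDensity ε k u) := fun u => by
      rw [tailDensity]; field_simp
    simp_rw [← h₁]
    have h₂ : ∀ u, z ≤ u → stableDensity ((z - u) / w ^ 2) = 0 := fun u hu =>
      stableDensity_of_nonpos (div_nonpos_of_nonpos_of_nonneg (by linarith) (by positivity))
    rcases le_total (((k : ℝ) + 1) * ε) z with h | h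
    · rw [intervalIntegral.integral_of_le h, ← integral_Icc_eq_integral_Ioc]
      refine setIntegral_eq_integral_of_forall_compl_eq_zero fun u hu => ?_
      rcases lt_or_ge u ((k + 1) * ε) with h' | h'
      · rw [jumpDensity_of_lt hε k h', mul_zero]
      · rw [h₂ u (not_lt.1 fun hc => hu ⟨h', hc.le⟩), zero_mul]
    -- Here the interval is reversed or degenerate, but the integrand vanishes identically.
    · have h₃ : ∀ u, stableDensity ((z - u) / w ^ 2) * jumpDensity ε k u = 0 := fun u => by
        rcases lt_or_ge u ((k + 1) * ε) with h' | h'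
        · rw [jumpDensity_of_lt hε k h', mul_zero]
        · rw [h₂ u (h.trans h'), zero_mul]
      simp_rw [h₃]
      simp

/-- The limiting density as a sum over a fixed range. -/
theorem limitDensity_eq {ε : ℝ} (hε : 0 < ε) (s : PlaneTree) (x : s.verts → ℝ)
    (y : s.leaves → ℝ) (hx : 0 < ∑ u, x u) (hy : 0 ≤ ∑ v, y v) {K : ℕ} (hK : 1 ≤ K * ε) :
    limitDensity ε s x y = 4 * √Real.pi / 4 ^ s.numLeaves *
      (∑ k ∈ Finset.range K, (-1) ^ k * ((∑ u, x u) ^ k / (k.factorial : ℝ)) *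
        tailDensity ε (∑ u, x u) k (1 - ∑ v, y v)) *
      ∏ v, forkDensity ε (y v) := by
  rw [limitDensity]
  set w := ∑ u, x u
  set z := 1 - ∑ v, y v with hz
  have h₁ : √Real.pi / 2 ^ (2 * (s.numLeaves : ℤ) - 2) = 4 * √Real.pi / 4 ^ s.numLeaves := by
    rw [zpow_sub₀ two_ne_zero, zpow_mul, zpow_natCast]
    norm_num
    ring
  have h₂ : ∀ k : ℕ, (-w) ^ ((k : ℤ) - 2) / (k.factorial : ℝ) * convolvedDensity ε w z k =
      (-1) ^ k * (w ^ k / (k.factorial : ℝ)) * tailDensity ε w k z := fun k => by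
    rw [convolvedDensity_eq hε hx, zpow_sub₀ (by simpa using hx.ne'), zpow_natCast, neg_pow]
    have : (-w) ^ (2 : ℤ) = w ^ 2 := by norm_cast; ring
    rw [this]
    field_simp
  simp_rw [h₂]
  rw [h₁]
  congr 2
  -- A term vanishes once kε ≥ z. This holds beyond K because Kε ≥ 1 ≥ z, and beyond ⌊z/ε⌋ by
  -- definition; for z < 0 every term vanishes.
  set f : ℕ → ℝ := fun k => (-1) ^ k * (w ^ k / (k.factorial : ℝ)) * tailDensity ε w k z
  have hf₁ : ∀ k, K ≤ k → f k = 0 := fun k hk => by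
    have hk' : (K : ℝ) ≤ k := by exact_mod_cast hk
    simp only [f]
    rw [tailDensity_of_le, mul_zero]
    nlinarith
  have hf₂ : ∀ k, (⌊z / ε⌋ + 1).toNat ≤ k → f k = 0 := fun k hk => by
    have hk' : ⌊z / ε⌋ + 1 ≤ k := by omega
    have hk'' : (⌊z / ε⌋ : ℝ) + 1 ≤ k := by exact_mod_cast hk'
    have h := Int.lt_floor_add_one (z / ε)
    rw [div_lt_iff₀ hε] at h
    simp only [f]
    rw [tailDensity_of_le, mul_zero]
    nlinarith
  rcases le_total K (⌊z / ε⌋ + 1).toNat with h | h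
  · exact (Finset.sum_subset (Finset.range_subset_range.2 h) fun k _ hk =>
      hf₁ k (by simpa using hk)).symm
  · exact Finset.sum_subset (Finset.range_subset_range.2 h) fun k _ hk =>
      hf₂ k (by simpa using hk)

end PlaneTree

/-! ### Convergence along sequences of skeletons -/

namespace PlaneTree

open BinaryTree

lemma tendsto_choose_div_pow {ι : Type*} {l : Filter ι} {m n : ι → ℕ} {w : ℝ}
    (hm : Tendsto m l atTop) (hw : Tendsto (fun i => (m i : ℝ) / √(n i)) l (𝓝 w)) (k : ℕ) :
    Tendsto (fun i => ((m i).choose k : ℝ) / √(n i) ^ k) l (𝓝 (w ^ k / k.factorial)) := by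
  have h₁ : Tendsto (fun j : ℕ => (j.choose k : ℝ) / (j ^ k / k.factorial)) atTop (𝓝 1) := by
    refine (Asymptotics.isEquivalent_iff_tendsto_one ?_).1 (isEquivalent_choose k)
    filter_upwards [eventually_gt_atTop 0] with j hj
    positivity
  have h₂ := (h₁.comp hm).mul ((hw.pow k).div_const (k.factorial : ℝ))
  rw [one_mul] at h₂
  refine h₂.congr' ?_
  filter_upwards [hm.eventually_gt_atTop 0] with i hi
  simp only [Function.comp]
  have : (0 : ℝ) < m i := by exact_mod_cast hi
  rw [div_pow]
  field_simp

/-- As Kε ≥ 1, inclusion-exclusion stops before K for every n. In each term the growth √n^k of the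
binomial coefficient compensates the decay of `tailProb`. -/
theorem tendsto_intCoeff_sub_pow {ι : Type*} {l : Filter ι} [l.IsCountablyGenerated] [l.NeBot]
    {ε : ℝ} (hε : 0 < ε) {n m : ι → ℕ} (hn : Tendsto n l atTop) {w : ℝ} (hw : 0 < w)
    (hm : Tendsto (fun i => (m i : ℝ) / √(n i)) l (𝓝 w)) (N : ι → ℤ) (z : ℝ)
    (hN : ∀ i, N i ≤ n i) (hz : Tendsto (fun i => (N i : ℝ) / n i) l (𝓝 z))
    {K : ℕ} (hK : 1 ≤ K * ε) :
    Tendsto (fun i => (n i : ℝ) * intCoeff ((stepSeries - tailSeries ⌊ε * n i⌋₊) ^ m i) (N i)) l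
      (𝓝 (∑ k ∈ Finset.range K, (-1) ^ k * (w ^ k / (k.factorial : ℝ)) *
        tailDensity ε w k z)) := by
  have hn' : Tendsto (fun i => (n i : ℝ)) l atTop := tendsto_natCast_atTop_atTop.comp hn
  have hs : Tendsto (fun i => √(n i : ℝ)) l atTop := Real.tendsto_sqrt_atTop.comp hn'
  have hn0 : ∀ᶠ i in l, (0 : ℝ) < n i := hn'.eventually_gt_atTop 0
  have hm' : Tendsto m l atTop := by
    have h := Tendsto.pos_mul_atTop hw hm hs
    have h' : Tendsto (fun i => (m i : ℝ)) l atTop := h.congr' (by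
      filter_upwards [hn0] with i hi
      rw [div_mul_cancel₀ _ (by positivity)])
    exact tendsto_natCast_atTop_iff.1 h'
  have hk : ∀ k : ℕ, Tendsto (fun i => ((m i - k : ℕ) : ℝ) / √(n i)) l (𝓝 w) := fun k => by
    have h := hm.sub ((tendsto_inv_atTop_zero.comp hs).const_mul (k : ℝ))
    rw [mul_zero, sub_zero] at h
    refine h.congr' ?_
    filter_upwards [hm'.eventually_ge_atTop k] with i hi
    rw [Nat.cast_sub hi, sub_div]
    rfl
  have main := tendsto_finsetSum (Finset.range K) fun k _ =>
    ((tendsto_choose_div_pow hm' hm k).const_mul ((-1 : ℝ) ^ k)).mul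
      (tendsto_tailProb hε hn hw (hk k) k N z hN hz)
  refine main.congr' ?_
  filter_upwards [hn0] with i hi
  have hlt : N i < K * ((⌊ε * n i⌋₊ : ℕ) + 1) := by
    have h₁ := Nat.lt_floor_add_one (ε * n i)
    have hK0 : (0 : ℝ) < K := by
      by_contra h
      have : (K : ℝ) * ε ≤ 0 := mul_nonpos_of_nonpos_of_nonneg (not_lt.1 h) hε.le
      linarith
    have h₂ : (n i : ℝ) < K * (⌊ε * n i⌋₊ + 1) := by
      calc (n i : ℝ) ≤ (K * ε) * n i := by nlinarith
        _ = K * (ε * n i) := by ring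
        _ < _ := by gcongr
    have h₃ : (n i : ℤ) < K * ((⌊ε * n i⌋₊ : ℕ) + 1) := by exact_mod_cast h₂
    exact (hN i).trans_lt h₃
  rw [intCoeff_sub_pow _ _ _ hlt, Finset.mul_sum]
  refine Finset.sum_congr rfl fun k _ => ?_
  have : √(n i : ℝ) ^ k ≠ 0 := by positivity
  field_simp

variable {s : PlaneTree} {ε : ℝ} {ξ : s.verts → ℝ} {η : s.leaves → ℝ}

/-- The exponent is 2 for each leaf of s, plus 1 for the chains, minus 3/2 for the denominator
`stepProb n`. The value 2ε is admitted for η because limit points of the box may have it. -/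
theorem tendsto_uniformProb_skeleton {ι : Type*} {l : Filter ι} [l.IsCountablyGenerated]
    [l.NeBot] (hε : 0 < ε) (hε' : ε < 1) {n : ι → ℕ} (hn : Tendsto n l atTop)
    (hξ : 0 < ∑ u, ξ u) (hη : ∀ v, ε < η v) (hη' : ∀ v, η v ≤ 2 * ε)
    {x : ι → s.verts → ℕ} {y : ι → s.leaves → ℕ}
    (hx : ∀ u, Tendsto (fun i => (x i u : ℝ) / √(n i)) l (𝓝 (ξ u)))
    (hy : ∀ v, Tendsto (fun i => (y i v : ℝ) / n i) l (𝓝 (η v))) :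
    Tendsto (fun i => (n i : ℝ) ^ (2 * (s.numLeaves : ℝ) - 1 / 2) *
      uniformProb (n i) {t | skeleton ⌊ε * n i⌋₊ t = ⟨s, x i, y i⟩}) l
      (𝓝 (limitDensity ε s ξ η)) := by
  obtain ⟨K, hK⟩ := exists_nat_ge (1 / ε)
  rw [div_le_iff₀ hε] at hK
  have hn' : Tendsto (fun i => (n i : ℝ)) l atTop := tendsto_natCast_atTop_atTop.comp hn
  have hn0 : ∀ᶠ i in l, (0 : ℝ) < n i := hn'.eventually_gt_atTop 0
  have hm : Tendsto (fun i => ((∑ u, x i u : ℕ) : ℝ) / √(n i)) l (𝓝 (∑ u, ξ u)) := by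
    refine (tendsto_finsetSum Finset.univ fun u _ => hx u).congr fun i => ?_
    rw [← Finset.sum_div, Nat.cast_sum]
  have hz : Tendsto (fun i => (((n i : ℤ) - (∑ v, y i v : ℕ) : ℤ) : ℝ) / n i) l
      (𝓝 (1 - ∑ v, η v)) := by
    refine ((tendsto_const_nhds (x := (1 : ℝ))).sub
      (tendsto_finsetSum Finset.univ fun v _ => hy v)).congr' ?_
    filter_upwards [hn0] with i hi
    rw [← Finset.sum_div]
    push_cast
    field_simp
  have h₁ := tendsto_intCoeff_sub_pow hε hn hξ hm _ _ (fun i => by omega) hz hK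
  have h₂ := tendsto_finsetProd (Finset.univ : Finset s.leaves) fun v _ =>
    tendsto_coeff_sub_sq hε hε' (hη v) (hη' v) hn (hy v)
  have h₃ := tendsto_stepProb_mul.comp hn
  have main := ((h₂.const_mul (2 / 4 ^ s.numLeaves)).mul h₁).div h₃ (by positivity)
  have e : limitDensity ε s ξ η = 2 / 4 ^ s.numLeaves * (∏ v, forkDensity ε (η v)) *
      (∑ k ∈ Finset.range K, (-1) ^ k * ((∑ u, ξ u) ^ k / (k.factorial : ℝ)) *
        tailDensity ε (∑ u, ξ u) k (1 - ∑ v, η v)) / (1 / (2 * √Real.pi)) := by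
    rw [limitDensity_eq hε s ξ η hξ
      (Finset.sum_nonneg fun v _ => hε.le.trans (hη v).le) hK]
    field_simp
    ring
  rw [e]
  refine main.congr' ?_
  have hyv : ∀ᶠ i in l, ∀ v, ⌊ε * n i⌋₊ < y i v := by
    rw [eventually_all]
    intro v
    filter_upwards [hn0, (hy v).eventually (lt_mem_nhds (hη v))] with i hi h
    rw [lt_div_iff₀ hi] at h
    exact (Nat.floor_lt (by positivity)).2 h
  filter_upwards [hn0, hyv, (hn'.const_mul_atTop hε).eventually_ge_atTop 1] with i hi hyi h1
  have ha : ⌊ε * n i⌋₊ < n i := by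
    rw [Nat.floor_lt (by positivity)]; nlinarith
  rw [uniformProb_skeleton_eq_stepProb (Nat.le_floor (by exact_mod_cast h1)) ha s _ _ hyi]
  simp only [Pi.div_apply, Function.comp]
  rw [Finset.prod_mul_distrib, Finset.prod_const, Finset.card_univ, Fintype.card_coe, card_leaves]
  rw [Real.rpow_sub hi, ← Real.sqrt_eq_rpow, show (2 * (s.numLeaves : ℝ)) =
    ((2 * s.numLeaves : ℕ) : ℝ) by push_cast; ring, Real.rpow_natCast, pow_mul]
  have := Real.sqrt_pos.2 hi
  field_simp

theorem tendsto_limitDensity {ι : Type*} {l : Filter ι} (hε : 0 < ε)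
    (hξ : 0 < ∑ u, ξ u) (hη : ∀ v, ε < η v) (hη' : ∀ v, η v ≤ 2 * ε)
    {x : ι → s.verts → ℝ} {y : ι → s.leaves → ℝ}
    (hx : ∀ u, Tendsto (fun i => x i u) l (𝓝 (ξ u)))
    (hy : ∀ v, Tendsto (fun i => y i v) l (𝓝 (η v))) (hy' : ∀ i v, y i v ≤ 2 * ε) :
    Tendsto (fun i => limitDensity ε s (x i) (y i)) l (𝓝 (limitDensity ε s ξ η)) := by
  obtain ⟨K, hK⟩ := exists_nat_ge (1 / ε)
  rw [div_le_iff₀ hε] at hK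
  have hw := tendsto_finsetSum (Finset.univ : Finset s.verts) fun u _ => hx u
  have hz := (tendsto_const_nhds (x := (1 : ℝ))).sub
    (tendsto_finsetSum (Finset.univ : Finset s.leaves) fun v _ => hy v)
  have h₁ := tendsto_finsetProd (Finset.univ : Finset s.leaves) fun v _ =>
    (continuousWithinAt_forkDensity (hη v) (hη' v)).tendsto.comp
      (tendsto_nhdsWithin_iff.2 ⟨hy v, Eventually.of_forall fun i => hy' i v⟩)
  have h₂ := tendsto_finsetSum (Finset.range K) fun k _ =>
    (((hw.pow k).div_const (k.factorial : ℝ)).const_mul ((-1 : ℝ) ^ k)).mul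
      ((continuousAt_tailDensity hε k hξ (1 - ∑ v, η v)).tendsto.comp (hw.prodMk_nhds hz))
  rw [limitDensity_eq hε s ξ η hξ (Finset.sum_nonneg fun v _ => hε.le.trans (hη v).le) hK]
  refine ((h₂.const_mul (4 * √Real.pi / 4 ^ s.numLeaves)).mul h₁).congr' ?_
  have hpos : ∀ᶠ i in l, ∀ v, 0 < y i v :=
    eventually_all.2 fun v => (hy v).eventually (lt_mem_nhds (hε.trans (hη v)))
  filter_upwards [hw.eventually (lt_mem_nhds hξ), hpos] with i hi hyi
  rw [limitDensity_eq hε s _ _ hi (Finset.sum_nonneg fun v _ => (hyi v).le) hK]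
  rfl

end PlaneTree

/-! ### Uniformity over the box by compactness -/

theorem mainTheorem2 (s : PlaneTree) (ε : ℝ) (hε : 0 < ε) (hε' : ε < 1) (M : ℝ) (hM : 1 / ε < M) :
    Tendsto
      (fun n : ℕ =>
        ⨆ (x : s.verts → ℕ) (y : s.leaves → ℕ)
          (_ : ((fun u => (x u : ℝ) / √(n : ℝ), fun v => (y v : ℝ) / (n : ℝ)) :
            (s.verts → ℝ) × (s.leaves → ℝ)) ∈ PlaneTree.box ε M s),
          ENNReal.ofReal
            |(n : ℝ) ^ (2 * (s.numLeaves : ℝ) - 1 / 2) *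
                PlaneTree.uniformProb n {t | PlaneTree.skeleton ⌊ε * (n : ℝ)⌋₊ t = ⟨s, x, y⟩} -
              PlaneTree.limitDensity ε s
                (fun u => (x u : ℝ) / √(n : ℝ)) (fun v => (y v : ℝ) / (n : ℝ))|)
      atTop (𝓝 0) := by
  have hM0 : 0 < M⁻¹ := inv_pos.2 (lt_trans (by positivity) hM)
  rw [ENNReal.tendsto_nhds_zero]
  intro δ hδ
  -- Otherwise infinitely many n have labels in the box with error above δ; such labels are chosen
  -- along a subsequence.
  by_contra hcon
  obtain ⟨φ, hφ, hP⟩ := extraction_of_frequently_atTop (not_eventually.1 hcon)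
  simp only [not_le, lt_iSup_iff] at hP
  choose x y hbox hlt using hP
  -- On the closed box |x| stays positive and each y_v stays above ε, so both convergence lemmas
  -- apply at any limit point.
  have hcomp : IsCompact ((Set.univ.pi fun _ : s.verts => Set.Icc M⁻¹ M) ×ˢ
      (Set.univ.pi fun _ : s.leaves => Set.Icc (ε + M⁻¹) (2 * ε))) :=
    (isCompact_univ_pi fun _ => isCompact_Icc).prod (isCompact_univ_pi fun _ => isCompact_Icc)
  obtain ⟨⟨ξ, η⟩, hmem, ψ, hψ, hlim⟩ := hcomp.tendsto_subseq (fun i =>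
    show ((fun u => (x i u : ℝ) / √(φ i : ℝ), fun v => (y i v : ℝ) / (φ i : ℝ)) :
      (s.verts → ℝ) × (s.leaves → ℝ)) ∈ _ from
    ⟨fun u _ => Set.Ioo_subset_Icc_self ((hbox i).1 u),
      fun v _ => Set.Ioo_subset_Icc_self ((hbox i).2 v)⟩)
  have hn : Tendsto (fun i => φ (ψ i)) atTop atTop :=
    hφ.tendsto_atTop.comp hψ.tendsto_atTop
  have hx : ∀ u, Tendsto (fun i => (x (ψ i) u : ℝ) / √(φ (ψ i) : ℝ)) atTop (𝓝 (ξ u)) :=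
    tendsto_pi_nhds.1 ((continuous_fst.tendsto _).comp hlim)
  have hy : ∀ v, Tendsto (fun i => (y (ψ i) v : ℝ) / (φ (ψ i) : ℝ)) atTop (𝓝 (η v)) :=
    tendsto_pi_nhds.1 ((continuous_snd.tendsto _).comp hlim)
  have hξ : 0 < ∑ u, ξ u :=
    Finset.sum_pos (fun u _ => hM0.trans_le (hmem.1 u trivial).1)
      ⟨⟨[], PlaneTree.nil_mem_verts s⟩, Finset.mem_univ _⟩
  have hη : ∀ v, ε < η v := fun v => by linarith [(hmem.2 v trivial).1]
  have hη' : ∀ v, η v ≤ 2 * ε := fun v => (hmem.2 v trivial).2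
  have h₁ := PlaneTree.tendsto_uniformProb_skeleton hε hε' hn hξ hη hη' hx hy
  have h₂ := PlaneTree.tendsto_limitDensity hε hξ hη hη' hx hy
    (fun i v => ((hbox (ψ i)).2 v).2.le)
  have h₃ := ENNReal.tendsto_ofReal (h₁.sub h₂).abs
  rw [sub_self, abs_zero, ENNReal.ofReal_zero] at h₃
  obtain ⟨i, hi⟩ := (h₃.eventually (gt_mem_nhds hδ)).exists
  exact lt_asymm hi (hlt (ψ i))
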